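/- Let $\epsilon\in\mathbb R\setminus\{0\}$, $c_1=\frac1{12\epsilon}$, $c_2=\frac1{192\epsilon^2}$, $c_3=\frac1{96\epsilon^2}$, $\sigma=\mathrm{diag}(-2,1,1,1)$. The three-component coupled Hirota (tcCH) system for $q_1,q_2,q_3:\mathbb R^2\to\mathbb C$ (functions of $(x,t)$) is $$i q_{a,t}+\tfrac12 q_{a,xx}+\big(|q_1|^2+|q_2|^2+|q_3|^2\big)q_a+i\epsilon\Big[q_{a,xxx}+3\big(2|q_a|^2+|q_b|^2+|q_c|^2\big)q_{a,x}+3q_a\big(q_b^*q_{b,x}+q_c^*q_{c,x}\big)\Big]=0$$ for $(a,b,c)=(1,2,3),(2,3,1),(3,1,2)$. Let $N\ge 0$, let $\lambda_1,\dots,\lambda_N\in\mathbb C$ be distinct with $\lambda_j=\xi_j+i\eta_j$, $\eta_j>0$, and let $\alpha_j,\beta_j,\gamma_j\in\mathbb C$. Put $\theta_j=i(c_1\lambda_jx+c_2\lambda_j^3t+c_3\lambda_j^2t)$, $w_j=e^{\theta_j\sigma}(\alpha_j,\beta_j,\gamma_j,1)^T$, $\hat w_j=w_j^\dagger$, and let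 $M=M(x,t)$ be the $N\times N$ matrix with entries $$m_{kj}=\frac{\hat w_kw_j}{\lambda_j-\lambda_k^*}=\frac{\alpha_k^*\alpha_je^{-2(\theta_k^*+\theta_j)}+(\beta_k^*\beta_j+\gamma_k^*\gamma_j+1)e^{\theta_k^*+\theta_j}}{\lambda_j-\lambda_k^*}.$$ Then: 1. $M(x,t)$ is invertible for all $(x,t)\in\mathbb R^2$. 2. For each $(x,t)$ consider the following reflectionless Riemann–Hilbert problem: $P_1$ is holomorphic in $\{\mathrm{Im}\,\lambda>0\}$ and continuous on its closure, $P_2$ is holomorphic in $\{\mathrm{Im}\,\lambda<0\}$ and continuous on its closure (both $4\times4$-matrix valued), $P_2P_1=\mathbb I$ on $\mathbb R$, $P_1,P_2\to\mathbb I$ as $\lambda\to\infty$, the zeros of $\det P_1$ in the open upper half-plane are exactly the $\lambda_j$ and are simple, those of $\det P_2$ in the open lower half-plane are exactly the $\lambda_j^*$ and are simple, $P_1(\lambda_j)w_j=0$ and $\hat w_jP_2(\lambda_j^*)=0$. It has exactly one solution, namely $$P_1(\lambda)=\mathbb I-\sum_{k,j=1}^N\frac{w_k\hat w_j(M^{-1})_{kj}}{\lambda-\lambda_j^*},\qquad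 P_2(\lambda)=\mathbb I+\sum_{k,j=1}^N\frac{w_k\hat w_j(M^{-1})_{kj}}{\lambda-\lambda_k},$$ and the potentials reconstructed from it, $q_i=-3ic_1\lim_{\lambda\to\infty}\lambda\,(P_1(\lambda))_{1,i+1}$, are $$q_1=3ic_1\sum_{k,j=1}^N\alpha_k\beta_j^*e^{-2\theta_k+\theta_j^*}(M^{-1})_{kj},\quad q_2=3ic_1\sum_{k,j=1}^N\alpha_k\gamma_j^*e^{-2\theta_k+\theta_j^*}(M^{-1})_{kj},\quad q_3=3ic_1\sum_{k,j=1}^N\alpha_ke^{-2\theta_k+\theta_j^*}(M^{-1})_{kj}.\qquad(*)$$ 3. The functions $(*)$ are $C^\infty$ on $\mathbb R^2$ and solve the tcCH system. 4. Suppose moreover $\epsilon>0$ and $\alpha_j\ne0$ for all $j$. For a triple $u=(u_1,u_2,u_3)$ of functions of $x$ let $Q$ be the $4\times4$ matrix with first row $(0,-u_1,-u_2,-u_3)$, first column $(0,u_1^*,u_2^*,u_3^*)^T$ and all other entries $0$. Let $J_\pm(x,\lambda)$, $\lambda\in\mathbb R$, denote Jost solutions: $J_x=i\lambda c_1[\sigma,J]+QJ$,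 $J_\pm\to\mathbb I$ as $x\to\pm\infty$. Let $S(\lambda)$ be the scattering matrix, $J_-E=J_+ES$ with $E=e^{ic_1\lambda\sigma x}$, and $R=S^{-1}$. Then for every fixed $t$ the triple $u=(q_1,q_2,q_3)(\cdot,t)$ given by $(*)$ is the unique triple with the following property: the Jost solutions and the scattering matrix exist for all $\lambda\in\mathbb R$; $u$ is reflectionless, i.e. $s_{21}=s_{31}=s_{41}=0$ and $r_{12}=r_{13}=r_{14}=0$ on $\mathbb R$; and the matrix $P_1$ formed from column 1 of $J_-$ and columns 2–4 of $J_+$, and the matrix $P_2$ formed from row 1 of $J_-^{-1}$ and rows 2–4 of $J_+^{-1}$, satisfy $\det P_1=s_{11}$, $\det P_2=r_{11}$ on $\mathbb R$ and extend to the upper and lower half-plane respectively as a solution of the Riemann–Hilbert problem of part 2, for every $x$. 5. For $N=1$, $(*)$ reads $$q_i=3ic_1\alpha_1\kappa_{1,i}^*e^{-2\theta_1+\theta_1^*}(M^{-1})_{11},\qquad M=(m_{11}),$$ and for $N=2$ (with $\lambda_1\ne\lambda_2$) it reads $$q_i=3ic_1\Big[\alpha_1\kappa_{1,i}^*e^{-2\theta_1+\theta_1^*}(M^{-1})_{11}+\alpha_1\kappa_{2,i}^*e^{-2\theta_1+\theta_2^*}(M^{-1})_{12}+\alpha_2\kappa_{1,i}^*e^{-2\theta_2+\theta_1^*}(M^{-1})_{21}+\alpha_2\kappa_{2,i}^*e^{-2\theta_2+\theta_2^*}(M^{-1})_{22}\Big],$$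 where $(\kappa_{j,1},\kappa_{j,2},\kappa_{j,3})=(\beta_j,\gamma_j,1)$; these are the one- and two-soliton solutions of the tcCH system. -/

import Mathlib

open Matrix Filter Topology Bornology
open scoped ComplexConjugate ContDiff

namespace TcCH

noncomputable section

/-! ### The three-component coupled Hirota system -/

/-- Left-hand side of the equation for the component `u`, the other two components
being `v` and `w`, at the point `(x, t)`. -/
def lhs (ε : ℝ) (u v w : ℝ → ℝ → ℂ) (x t : ℝ) : ℂ :=
  Complex.I * deriv (fun s => u x s) t
    + 1 / 2 * iteratedDeriv 2 (fun y => u y t) x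
    + ((‖u x t‖ ^ 2 + ‖v x t‖ ^ 2 + ‖w x t‖ ^ 2 : ℝ) : ℂ) * u x t
    + Complex.I * (ε : ℂ) *
      (iteratedDeriv 3 (fun y => u y t) x
        + 3 * ((2 * ‖u x t‖ ^ 2 + ‖v x t‖ ^ 2 + ‖w x t‖ ^ 2 : ℝ) : ℂ) * deriv (fun y => u y t) x
        + 3 * u x t * (conj (v x t) * deriv (fun y => v y t) x
            + conj (w x t) * deriv (fun y => w y t) x))

/-- `(q 0, q 1, q 2)` is a smooth solution of the system on the whole `(x, t)`-plane. -/
structure IsSolution (ε : ℝ) (q : Fin 3 → ℝ → ℝ → ℂ) : Prop where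
  smooth : ∀ i, ContDiff ℝ ∞ (fun p : ℝ × ℝ => q i p.1 p.2)
  eq₁ : ∀ x t, lhs ε (q 0) (q 1) (q 2) x t = 0
  eq₂ : ∀ x t, lhs ε (q 1) (q 2) (q 0) x t = 0
  eq₃ : ∀ x t, lhs ε (q 2) (q 0) (q 1) x t = 0

/-! ### Phases, norming vectors and the soliton formula -/

/-- `c₁ = 1 / (12 ε)`. -/
def c₁ (ε : ℝ) : ℂ := 1 / (12 * (ε : ℂ))

/-- `c₂ = 1 / (192 ε ^ 2)`. -/
def c₂ (ε : ℝ) : ℂ := 1 / (192 * (ε : ℂ) ^ 2)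

/-- `c₃ = 1 / (96 ε ^ 2)`. -/
def c₃ (ε : ℝ) : ℂ := 1 / (96 * (ε : ℂ) ^ 2)

/-- The phase `θ = i (c₁ z x + c₂ z ^ 3 t + c₃ z ^ 2 t)` at the spectral value `z`. -/
def phase (ε : ℝ) (z : ℂ) (x t : ℝ) : ℂ :=
  Complex.I * (c₁ ε * z * x + c₂ ε * z ^ 3 * t + c₃ ε * z ^ 2 * t)

/-- `w = e ^ (θ σ) (a, b, g, 1)ᵀ`, where `σ = diag (-2, 1, 1, 1)`. -/
def normVec (ε : ℝ) (z a b g : ℂ) (x t : ℝ) : Fin 4 → ℂ :=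
  ![a * Complex.exp (-2 * phase ε z x t), b * Complex.exp (phase ε z x t),
    g * Complex.exp (phase ε z x t), Complex.exp (phase ε z x t)]

/-- The family of norming vectors `w_j (x, t)`. -/
def normVecs {N : ℕ} (ε : ℝ) (lam α β γ : Fin N → ℂ) (x t : ℝ) (j : Fin N) : Fin 4 → ℂ :=
  normVec ε (lam j) (α j) (β j) (γ j) x t

/-- The matrix with entries `m_kj = ŵ_k w_j / (λ_j - λ_k^*)`, where `ŵ_k` is the conjugate
transpose of `w_k`. -/
def gramMatrix {N : ℕ} (lam : Fin N → ℂ) (w : Fin N → Fin 4 → ℂ) : Matrix (Fin N) (Fin N) ℂ :=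
  Matrix.of fun k j => (star (w k) ⬝ᵥ w j) / (lam j - conj (lam k))

/-- The matrix `M (x, t)`. -/
def solitonMatrix {N : ℕ} (ε : ℝ) (lam α β γ : Fin N → ℂ) (x t : ℝ) :
    Matrix (Fin N) (Fin N) ℂ :=
  gramMatrix lam (normVecs ε lam α β γ x t)

/-- The coefficients occurring in `q₁`, `q₂`, `q₃`, before conjugation. -/
def coeff (b g : ℂ) : Fin 3 → ℂ := ![b, g, 1]

/-- The `N`-soliton formula. -/
def nSoliton {N : ℕ} (ε : ℝ) (lam α β γ : Fin N → ℂ) (i : Fin 3) (x t : ℝ) : ℂ :=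
  3 * Complex.I * c₁ ε * ∑ k, ∑ j,
    α k * conj (coeff (β j) (γ j) i)
      * Complex.exp (-2 * phase ε (lam k) x t + conj (phase ε (lam j) x t))
      * (solitonMatrix ε lam α β γ x t)⁻¹ k j

/-- The entry `m_kj` written out, for the data `(z', a', b', g')` of index `k` and
`(z, a, b, g)` of index `j`. -/
def entry (ε : ℝ) (z' a' b' g' z a b g : ℂ) (x t : ℝ) : ℂ :=
  (conj a' * a * Complex.exp (-2 * (conj (phase ε z' x t) + phase ε z x t))
    + (conj b' * b + conj g' * g + 1) * Complex.exp (conj (phase ε z' x t) + phase ε z x t))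
  / (z - conj z')

/-- The one-soliton formula. -/
def oneSoliton (ε : ℝ) (z₁ a₁ b₁ g₁ : ℂ) (i : Fin 3) (x t : ℝ) : ℂ :=
  let M : Matrix (Fin 1) (Fin 1) ℂ := !![entry ε z₁ a₁ b₁ g₁ z₁ a₁ b₁ g₁ x t]
  let θ₁ := phase ε z₁ x t
  3 * Complex.I * c₁ ε * a₁ * conj (coeff b₁ g₁ i) * Complex.exp (-2 * θ₁ + conj θ₁) * M⁻¹ 0 0

/-- The two-soliton formula. -/
def twoSoliton (ε : ℝ) (z₁ a₁ b₁ g₁ z₂ a₂ b₂ g₂ : ℂ) (i : Fin 3) (x t : ℝ) : ℂ :=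
  let M : Matrix (Fin 2) (Fin 2) ℂ :=
    !![entry ε z₁ a₁ b₁ g₁ z₁ a₁ b₁ g₁ x t, entry ε z₁ a₁ b₁ g₁ z₂ a₂ b₂ g₂ x t;
       entry ε z₂ a₂ b₂ g₂ z₁ a₁ b₁ g₁ x t, entry ε z₂ a₂ b₂ g₂ z₂ a₂ b₂ g₂ x t]
  let θ₁ := phase ε z₁ x t
  let θ₂ := phase ε z₂ x t
  3 * Complex.I * c₁ ε * a₁ * conj (coeff b₁ g₁ i) * Complex.exp (-2 * θ₁ + conj θ₁) * M⁻¹ 0 0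
  + 3 * Complex.I * c₁ ε * a₁ * conj (coeff b₂ g₂ i) * Complex.exp (-2 * θ₁ + conj θ₂) * M⁻¹ 0 1
  + 3 * Complex.I * c₁ ε * a₂ * conj (coeff b₁ g₁ i) * Complex.exp (-2 * θ₂ + conj θ₁) * M⁻¹ 1 0
  + 3 * Complex.I * c₁ ε * a₂ * conj (coeff b₂ g₂ i) * Complex.exp (-2 * θ₂ + conj θ₂) * M⁻¹ 1 1

/-! ### The reflectionless Riemann-Hilbert problem -/

/-- `(P₁, P₂)` solves the Riemann-Hilbert problem with jump matrix `1` (no reflection), with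
simple zeros `λ_j` of `det P₁` in the upper half-plane, `λ_j^*` of `det P₂` in the lower
half-plane, and kernel vectors `w_j`, `ŵ_j = w_j†`. -/
structure IsRHSolution {N : ℕ} (lam : Fin N → ℂ) (w : Fin N → Fin 4 → ℂ)
    (P₁ P₂ : ℂ → Matrix (Fin 4) (Fin 4) ℂ) : Prop where
  analytic₁ : ∀ a b, DifferentiableOn ℂ (fun z => P₁ z a b) {z | 0 < z.im}
  continuous₁ : ContinuousOn P₁ {z | 0 ≤ z.im}
  analytic₂ : ∀ a b, DifferentiableOn ℂ (fun z => P₂ z a b) {z | z.im < 0}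
  continuous₂ : ContinuousOn P₂ {z | z.im ≤ 0}
  jump : ∀ k : ℝ, P₂ k * P₁ k = 1
  normalized₁ : Tendsto P₁ (cobounded ℂ ⊓ 𝓟 {z | 0 ≤ z.im}) (𝓝 1)
  normalized₂ : Tendsto P₂ (cobounded ℂ ⊓ 𝓟 {z | z.im ≤ 0}) (𝓝 1)
  zeros₁ : ∀ z : ℂ, 0 < z.im → ((P₁ z).det = 0 ↔ ∃ j, z = lam j)
  simple₁ : ∀ j, deriv (fun z => (P₁ z).det) (lam j) ≠ 0
  zeros₂ : ∀ z : ℂ, z.im < 0 → ((P₂ z).det = 0 ↔ ∃ j, z = conj (lam j))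
  simple₂ : ∀ j, deriv (fun z => (P₂ z).det) (conj (lam j)) ≠ 0
  kernel₁ : ∀ j, P₁ (lam j) *ᵥ w j = 0
  kernel₂ : ∀ j, star (w j) ᵥ* P₂ (conj (lam j)) = 0

/-- `1 - ∑ w_k ŵ_j (M⁻¹)_kj / (z - λ_j^*)`. -/
def rhUpper {N : ℕ} (lam : Fin N → ℂ) (w : Fin N → Fin 4 → ℂ) (z : ℂ) :
    Matrix (Fin 4) (Fin 4) ℂ :=
  1 - ∑ k, ∑ j, ((gramMatrix lam w)⁻¹ k j / (z - conj (lam j))) • vecMulVec (w k) (star (w j))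

/-- `1 + ∑ w_k ŵ_j (M⁻¹)_kj / (z - λ_k)`. -/
def rhLower {N : ℕ} (lam : Fin N → ℂ) (w : Fin N → Fin 4 → ℂ) (z : ℂ) :
    Matrix (Fin 4) (Fin 4) ℂ :=
  1 + ∑ k, ∑ j, ((gramMatrix lam w)⁻¹ k j / (z - lam k)) • vecMulVec (w k) (star (w j))

/-! ### The spectral problem and its scattering data -/

/-- The diagonal entries of `σ = diag (-2, 1, 1, 1)`. -/
def sig : Fin 4 → ℂ := ![-2, 1, 1, 1]

/-- The potential matrix `Q` of a triple of functions of `x`. -/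
def potential (u : Fin 3 → ℝ → ℂ) (x : ℝ) : Matrix (Fin 4) (Fin 4) ℂ :=
  !![0, -u 0 x, -u 1 x, -u 2 x;
     conj (u 0 x), 0, 0, 0;
     conj (u 1 x), 0, 0, 0;
     conj (u 2 x), 0, 0, 0]

/-- `J` solves `J_x = i k c₁ [σ, J] + Q J` and tends to the identity along `l`
(`l = atBot` for `J₋`, `l = atTop` for `J₊`). -/
structure IsJost (ε : ℝ) (u : Fin 3 → ℝ → ℂ) (l : Filter ℝ) (k : ℝ)
    (J : ℝ → Matrix (Fin 4) (Fin 4) ℂ) : Prop where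
  ode : ∀ x a b, HasDerivAt (fun y => J y a b)
    (((Complex.I * k * c₁ ε) • (diagonal sig * J x - J x * diagonal sig)
      + potential u x * J x) a b) x
  normalized : Tendsto J l (𝓝 1)

/-- `E = e ^ (i c₁ k σ x)`. -/
def freeSol (ε : ℝ) (k x : ℝ) : Matrix (Fin 4) (Fin 4) ℂ :=
  diagonal fun a => Complex.exp (Complex.I * c₁ ε * k * sig a * x)

/-- The potential `u` (a triple of functions of `x`) is reflectionless, with discrete scattering
data given by the simple zeros `λ_j` of `det P₁` and the kernel vectors `w_j (x)`. -/
def IsReflectionless {N : ℕ} (ε : ℝ) (u : Fin 3 → ℝ → ℂ) (lam : Fin N → ℂ)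
    (w : ℝ → Fin N → Fin 4 → ℂ) : Prop :=
  ∃ (Jm Jp : ℝ → ℝ → Matrix (Fin 4) (Fin 4) ℂ) (S : ℝ → Matrix (Fin 4) (Fin 4) ℂ)
    (P₁ P₂ : ℝ → ℂ → Matrix (Fin 4) (Fin 4) ℂ),
    -- Jost solutions
    (∀ k, IsJost ε u atBot k (Jm k)) ∧ (∀ k, IsJost ε u atTop k (Jp k)) ∧
    -- the scattering matrix
    (∀ k x, Jm k x * freeSol ε k x = Jp k x * freeSol ε k x * S k) ∧
    -- no reflection
    (∀ k (i : Fin 3), S k i.succ 0 = 0 ∧ (S k)⁻¹ 0 i.succ = 0) ∧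
    -- `P₁` is assembled from columns of the Jost solutions, `P₂` from rows of their inverses
    (∀ (k x : ℝ) a, P₁ x k a 0 = Jm k x a 0 ∧ ∀ i : Fin 3, P₁ x k a i.succ = Jp k x a i.succ) ∧
    (∀ (k x : ℝ) b, P₂ x k 0 b = (Jm k x)⁻¹ 0 b ∧
      ∀ i : Fin 3, P₂ x k i.succ b = (Jp k x)⁻¹ i.succ b) ∧
    -- on the real line `det P₁ = s₁₁` and `det P₂ = r₁₁`
    (∀ k x : ℝ, (P₁ x k).det = S k 0 0 ∧ (P₂ x k).det = (S k)⁻¹ 0 0) ∧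
    (∀ x, IsRHSolution lam (w x) (P₁ x) (P₂ x))

end

end TcCH

/-!
The `N`-soliton formula comes from a reflectionless Riemann-Hilbert problem, whose solution is the
rational matrix `rhUpper = 1 - W M⁻¹ (z - Λ*)⁻¹ Wᴴ`, with `W` the `4 × N` matrix of the norming
vectors, `Λ = diag (λ_j)` and `Λ*` its conjugate. Everything algebraic follows from the Lyapunov
equation `M Λ - Λ* M = Wᴴ W` (`gramMatrix_lyapunov`). Since `M` is skew-Hermitian, its kernel is
annihilated by `W` and invariant under `Λ`; as the `λ_j` are distinct, a Vandermonde determinant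
leaves only zero, so `M` is invertible. The inverse, determinant and kernels of `rhUpper` are read
off from the same equation.

For another solution `(P₁, P₂)`, the matrix `P₁ * rhLower` in the upper half-plane and the inverse
of `rhUpper * P₂` in the lower one are holomorphic, because the kernel conditions and the simplicity
of the zeros cancel all poles, and they agree on the real line. A Liouville theorem for two
half-planes (`eq_const_of_eq_on_real`), proved with the maximum principle, shows that both are the
identity.

The `x`-flow of the norming vectors makes `rhUpper` a solution of the spectral problem
(`hasEntryDerivAt_rhUpper`). Let `S_n` be the coefficients of `S = rhUpper σ rhLower` at infinity
(`S_(n+1)` is `dressedSig n`). Then the potential matrix is `i c₁ S_1`,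
`∂ₓ S_n = i c₁ ([σ, S_(n+1)] + [S_1, S_n])` and `∂ₜ S_1 = i [σ, c₂ S_4 + c₃ S_3]`, while
`S ^ 2 + S = 2`, because `S` is similar to `σ`. The quadratic relation gives the diagonal blocks of
`S_2` and `S_3`, and eliminating the remaining off-diagonal entries yields the coupled Hirota system
(`lhs_eq_zero_of_hierarchy`).

For the scattering statement, the lines spanned by the norming vectors converge as `x → ±∞`, so
`rhUpper` converges to matrices that commute with `σ`; normalizing by these limits gives the Jost
solutions and a block diagonal scattering matrix. Conversely, the matrix `P₁` of a reflectionless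
potential `u` with the same data is `rhUpper` by uniqueness, so both potential matrices satisfy
`P₁' = Q P₁` at `k = 0`, and they agree because `P₁` is invertible there.
-/

namespace TcCH

/-! ### The Gram matrix of the norming vectors -/

/-- The `4 × N` matrix whose columns are the vectors `w_j`. -/
def frame {N : ℕ} (w : Fin N → Fin 4 → ℂ) : Matrix (Fin 4) (Fin N) ℂ :=
  Matrix.of fun a j => w j a

section Gram

variable {N : ℕ} {lam : Fin N → ℂ} {w : Fin N → Fin 4 → ℂ}

lemma sub_conj_ne_zero {z' z : ℂ} (h' : 0 < z'.im) (h : 0 < z.im) : z - conj z' ≠ 0 := by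
  intro h0
  have := congrArg Complex.im h0
  simp at this
  linarith

/-- The Lyapunov equation `M Λ - Λ* M = Wᴴ W` for the Gram matrix. -/
lemma gramMatrix_lyapunov (him : ∀ j, 0 < (lam j).im) :
    gramMatrix lam w * diagonal lam - diagonal (fun j => conj (lam j)) * gramMatrix lam w
      = (frame w)ᴴ * frame w := by
  ext k j
  have h := sub_conj_ne_zero (him k) (him j)
  rw [Matrix.sub_apply, mul_diagonal, diagonal_mul, Matrix.mul_apply]
  simp only [gramMatrix, frame, of_apply, conjTranspose_apply, dotProduct, Pi.star_apply]
  field_simp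

lemma gramMatrix_conjTranspose : (gramMatrix lam w)ᴴ = -gramMatrix lam w := by
  ext k j
  simp only [gramMatrix, conjTranspose_apply, of_apply, Matrix.neg_apply]
  rw [star_div₀, star_dotProduct, star_star, dotProduct_comm, ← div_neg]
  simp

open scoped ComplexOrder in
/-- A vector annihilated by the Gram matrix is annihilated by the frame, and so is its image
under `diagonal lam`. -/
lemma frame_mulVec_eq_zero (him : ∀ j, 0 < (lam j).im) {v : Fin N → ℂ}
    (hv : gramMatrix lam w *ᵥ v = 0) :
    frame w *ᵥ v = 0 ∧ gramMatrix lam w *ᵥ (diagonal lam *ᵥ v) = 0 := by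
  have h1 : star v ᵥ* gramMatrix lam w = 0 := by
    have := congrArg star hv
    rw [star_mulVec, gramMatrix_conjTranspose, vecMul_neg] at this
    simpa using this
  have hL := gramMatrix_lyapunov (w := w) him
  have h3 : frame w *ᵥ v = 0 := by
    rw [← dotProduct_star_self_eq_zero, star_mulVec, ← dotProduct_mulVec,
      mulVec_mulVec, ← hL, sub_mulVec, ← mulVec_mulVec, ← mulVec_mulVec, hv, mulVec_zero,
      sub_zero, dotProduct_mulVec, h1, zero_dotProduct]
  refine ⟨h3, ?_⟩
  rw [mulVec_mulVec, sub_eq_iff_eq_add.1 hL, add_mulVec, ← mulVec_mulVec, ← mulVec_mulVec, h3, hv]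
  simp

/-- The kernel of the Gram matrix is invariant under `diagonal lam` and annihilated by the frame, so
the invertibility of the Vandermonde matrix of the distinct `λ_j` forces it to vanish. -/
lemma gramMatrix_det_isUnit (hlam : Function.Injective lam) (him : ∀ j, 0 < (lam j).im)
    (hw : ∀ j, w j ≠ 0) : IsUnit (gramMatrix lam w).det := by
  rw [isUnit_iff_ne_zero]
  intro h0
  obtain ⟨v, hv0, hv⟩ := exists_mulVec_eq_zero_iff.2 h0
  have key : ∀ n : ℕ, gramMatrix lam w *ᵥ (fun j => lam j ^ n * v j) = 0 := by
    intro n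
    induction n with
    | zero => simpa using hv
    | succ n ih =>
      rw [← (frame_mulVec_eq_zero him ih).2]
      congr 1
      ext j
      rw [mulVec_diagonal]
      ring
  -- the powers of `lam` turn the moments of `v_j w_j` into a Vandermonde system
  apply hv0
  ext j
  by_contra hj
  apply hw j
  ext a
  have := Matrix.eq_zero_of_forall_pow_sum_mul_pow_eq_zero (v := fun j => v j * w j a) hlam
    (fun i => by
      have := congrFun (frame_mulVec_eq_zero him (key i)).1 a
      simp only [mulVec, dotProduct, frame, of_apply, Pi.zero_apply] at this
      rw [← this]
      exact Finset.sum_congr rfl fun j _ => by ring)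
  have := congrFun this j
  simpa [show v j ≠ 0 from hj] using this

end Gram

/-! ### The rational solution of the Riemann-Hilbert problem -/

section Dressing

variable {N : ℕ} {W : Matrix (Fin 4) (Fin N) ℂ} {V : Matrix (Fin N) (Fin 4) ℂ}
  {A A' B B' G K : Matrix (Fin N) (Fin N) ℂ}

/-- In this lemma and the next four, `A` and `B` stand for the diagonal matrices `z - Λ` and
`z - Λ*`, `G` for the Gram matrix and `V` for `Wᴴ`. -/
lemma dressing_mul (h : B * G - G * A = V * W) (hKG : K * G = 1) (hGK : G * K = 1)
    (hA : A' * A = 1) (hB : B * B' = 1) :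
    (1 + W * A' * K * V) * (1 - W * K * B' * V) = 1 := by
  have h1 : W * A' * K * V * (W * K * B' * V) = W * A' * K * V - W * K * B' * V := by
    calc W * A' * K * V * (W * K * B' * V)
        = W * A' * K * (V * W) * K * B' * V := by simp only [Matrix.mul_assoc]
      _ = W * A' * K * B * (G * K) * B' * V - W * A' * (K * G) * A * K * B' * V := by
          rw [← h]; simp only [Matrix.mul_assoc, Matrix.mul_sub, Matrix.sub_mul]
      _ = W * A' * K * (B * B') * V - W * (A' * A) * K * B' * V := by
          rw [hGK, hKG]; simp only [Matrix.mul_assoc, Matrix.one_mul]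
      _ = _ := by rw [hA, hB]; simp
  rw [Matrix.add_mul, Matrix.mul_sub, Matrix.mul_sub, Matrix.one_mul, Matrix.one_mul,
    Matrix.mul_one, h1]
  abel

lemma dressing_mul_frame (h : B * G - G * A = V * W) (hKG : K * G = 1) (hB : B' * B = 1) :
    (1 - W * K * B' * V) * W = W * K * B' * G * A := by
  calc (1 - W * K * B' * V) * W = W - W * K * B' * (V * W) := by
        simp only [Matrix.mul_assoc, Matrix.sub_mul, Matrix.one_mul]
    _ = W - W * K * (B' * B) * G + W * K * B' * G * A := by
        rw [← h]; simp only [Matrix.mul_assoc, Matrix.mul_sub]; abel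
    _ = W - W * (K * G) + W * K * B' * G * A := by
        rw [hB]; simp only [Matrix.mul_assoc, Matrix.one_mul]
    _ = _ := by rw [hKG]; simp

lemma coframe_mul_dressing (h : B * G - G * A = V * W) (hGK : G * K = 1) (hA : A * A' = 1) :
    V * (1 + W * A' * K * V) = B * (G * A' * K * V) := by
  calc V * (1 + W * A' * K * V) = V + (V * W) * A' * K * V := by
        simp only [Matrix.mul_assoc, Matrix.mul_add, Matrix.mul_one]
    _ = V - G * (A * A') * K * V + B * (G * A' * K * V) := by
        rw [← h]; simp only [Matrix.mul_assoc, Matrix.sub_mul]; abel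
    _ = V - (G * K) * V + B * (G * A' * K * V) := by rw [hA]; simp
    _ = _ := by rw [hGK]; simp

lemma det_dressing (h : B * G - G * A = V * W) (hKG : K * G = 1) (hGK : G * K = 1)
    (hB : B' * B = 1) :
    (1 - W * K * B' * V).det = B'.det * A.det := by
  have h1 : B' * V * (W * K) = 1 - B' * G * A * K := by
    calc B' * V * (W * K) = B' * (V * W) * K := by simp only [Matrix.mul_assoc]
      _ = (B' * B) * (G * K) - B' * G * A * K := by
        rw [← h]; simp only [Matrix.mul_assoc, Matrix.mul_sub, Matrix.sub_mul]
      _ = _ := by rw [hB, hGK, Matrix.one_mul]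
  have h2 : K.det * G.det = 1 := by rw [← det_mul, hKG, det_one]
  rw [show W * K * B' * V = W * K * (B' * V) by simp only [Matrix.mul_assoc],
    det_one_sub_mul_comm, h1, sub_sub_cancel, det_mul, det_mul, det_mul]
  linear_combination B'.det * A.det * h2

lemma det_dressing' (h : B * G - G * A = V * W) (hKG : K * G = 1)
    (hA : A' * A = 1) :
    (1 + W * A' * K * V).det = A'.det * B.det := by
  have h1 : A' * K * V * W = A' * K * B * G - 1 := by
    calc A' * K * V * W = A' * K * (V * W) := by simp only [Matrix.mul_assoc]
      _ = A' * K * B * G - A' * (K * G) * A := by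
        rw [← h]; simp only [Matrix.mul_assoc, Matrix.mul_sub]
      _ = _ := by rw [hKG, Matrix.mul_one, hA]
  have h2 : K.det * G.det = 1 := by rw [← det_mul, hKG, det_one]
  rw [show W * A' * K * V = W * (A' * K * V) by simp only [Matrix.mul_assoc],
    det_one_add_mul_comm, h1, add_sub_cancel, det_mul, det_mul, det_mul]
  linear_combination A'.det * B.det * h2

end Dressing

section Rational

variable {N : ℕ} {lam : Fin N → ℂ} {w : Fin N → Fin 4 → ℂ}

lemma rhUpper_eq (z : ℂ) : rhUpper lam w z = 1 - frame w * (gramMatrix lam w)⁻¹ *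
    diagonal (fun j => (z - conj (lam j))⁻¹) * (frame w)ᴴ := by
  rw [rhUpper]
  congr 1
  ext a b
  rw [Matrix.mul_apply]
  simp only [mul_diagonal]
  simp only [Matrix.mul_apply, Matrix.sum_apply, Matrix.smul_apply, vecMulVec_apply,
    frame, of_apply, conjTranspose_apply, Pi.star_apply, smul_eq_mul, Finset.sum_mul]
  rw [Finset.sum_comm]
  exact Finset.sum_congr rfl fun j _ => Finset.sum_congr rfl fun k _ => by rw [div_eq_mul_inv]; ring

lemma rhLower_eq (z : ℂ) : rhLower lam w z = 1 + frame w *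
    diagonal (fun j => (z - lam j)⁻¹) * (gramMatrix lam w)⁻¹ * (frame w)ᴴ := by
  rw [rhLower]
  congr 1
  ext a b
  rw [Matrix.mul_apply]
  simp only [Matrix.mul_apply (N := (gramMatrix lam w)⁻¹), mul_diagonal]
  simp only [Matrix.sum_apply, Matrix.smul_apply, vecMulVec_apply,
    frame, of_apply, conjTranspose_apply, Pi.star_apply, smul_eq_mul, Finset.sum_mul]
  rw [Finset.sum_comm]
  exact Finset.sum_congr rfl fun j _ => Finset.sum_congr rfl fun k _ => by rw [div_eq_mul_inv]; ring

lemma gramMatrix_lyapunov_shift (him : ∀ j, 0 < (lam j).im) (z : ℂ) :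
    diagonal (fun j => z - conj (lam j)) * gramMatrix lam w
      - gramMatrix lam w * diagonal (fun j => z - lam j) = (frame w)ᴴ * frame w := by
  rw [← gramMatrix_lyapunov him]
  ext k j
  simp only [Matrix.sub_apply, mul_diagonal, diagonal_mul]
  ring

lemma diagonal_mul_inv {d : Fin N → ℂ} (h : ∀ j, d j ≠ 0) :
    diagonal d * diagonal (fun j => (d j)⁻¹) = 1 := by
  rw [diagonal_mul_diagonal, ← diagonal_one]
  exact congrArg _ (funext fun j => mul_inv_cancel₀ (h j))

lemma diagonal_inv_mul {d : Fin N → ℂ} (h : ∀ j, d j ≠ 0) :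
    diagonal (fun j => (d j)⁻¹) * diagonal d = 1 := by
  rw [diagonal_mul_diagonal, ← diagonal_one]
  exact congrArg _ (funext fun j => inv_mul_cancel₀ (h j))

variable (hlam : Function.Injective lam) (him : ∀ j, 0 < (lam j).im) (hw : ∀ j, w j ≠ 0)

lemma sub_conj_ne_zero_of_im_nonneg (him : ∀ j, 0 < (lam j).im) {z : ℂ} (hz : 0 ≤ z.im)
    (j : Fin N) : z - conj (lam j) ≠ 0 := by
  intro h0
  have := congrArg Complex.im h0
  simp at this
  linarith [him j]

lemma sub_ne_zero_of_im_nonpos (him : ∀ j, 0 < (lam j).im) {z : ℂ} (hz : z.im ≤ 0)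
    (j : Fin N) : z - lam j ≠ 0 := by
  intro h0
  have := congrArg Complex.im h0
  simp at this
  linarith [him j]

include hlam him hw

lemma rhLower_mul_rhUpper {z : ℂ} (h : ∀ j, z - lam j ≠ 0) (h' : ∀ j, z - conj (lam j) ≠ 0) :
    rhLower lam w z * rhUpper lam w z = 1 := by
  have hu := gramMatrix_det_isUnit hlam him hw
  rw [rhUpper_eq, rhLower_eq]
  exact dressing_mul (gramMatrix_lyapunov_shift him z) (nonsing_inv_mul _ hu) (mul_nonsing_inv _ hu)
    (diagonal_inv_mul h) (diagonal_mul_inv h')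

lemma rhUpper_det {z : ℂ} (h' : ∀ j, z - conj (lam j) ≠ 0) :
    (rhUpper lam w z).det = ∏ j, (z - lam j) / (z - conj (lam j)) := by
  have hu := gramMatrix_det_isUnit hlam him hw
  rw [rhUpper_eq, det_dressing (gramMatrix_lyapunov_shift him z) (nonsing_inv_mul _ hu)
    (mul_nonsing_inv _ hu) (diagonal_inv_mul h'), det_diagonal, det_diagonal,
    ← Finset.prod_mul_distrib]
  exact Finset.prod_congr rfl fun j _ => by rw [div_eq_mul_inv, mul_comm]

lemma rhLower_det {z : ℂ} (h : ∀ j, z - lam j ≠ 0) :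
    (rhLower lam w z).det = ∏ j, (z - conj (lam j)) / (z - lam j) := by
  have hu := gramMatrix_det_isUnit hlam him hw
  rw [rhLower_eq, det_dressing' (gramMatrix_lyapunov_shift him z) (nonsing_inv_mul _ hu)
    (diagonal_inv_mul h), det_diagonal, det_diagonal, ← Finset.prod_mul_distrib]
  exact Finset.prod_congr rfl fun j _ => by rw [div_eq_mul_inv, mul_comm]

lemma rhUpper_kernel (j : Fin N) : rhUpper lam w (lam j) *ᵥ w j = 0 := by
  have hu := gramMatrix_det_isUnit hlam him hw
  have h := dressing_mul_frame (gramMatrix_lyapunov_shift (w := w) him (lam j))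
    (nonsing_inv_mul _ hu)
    (diagonal_inv_mul (sub_conj_ne_zero_of_im_nonneg him (him j).le))
  rw [← rhUpper_eq] at h
  ext a
  have := congrFun (congrFun h a) j
  rwa [mul_diagonal, sub_self, mul_zero] at this

lemma rhLower_kernel (j : Fin N) : star (w j) ᵥ* rhLower lam w (conj (lam j)) = 0 := by
  have hu := gramMatrix_det_isUnit hlam him hw
  have h := coframe_mul_dressing (gramMatrix_lyapunov_shift (w := w) him (conj (lam j)))
    (mul_nonsing_inv _ hu)
    (diagonal_mul_inv (sub_ne_zero_of_im_nonpos him (by simpa using (him j).le)))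
  rw [← rhLower_eq] at h
  ext a
  have := congrFun (congrFun h j) a
  rwa [diagonal_mul, sub_self, zero_mul] at this

end Rational

/-! ### A Liouville theorem for two half-planes -/

lemma closure_upper_subset : closure {z : ℂ | 0 < z.im} ⊆ {z | 0 ≤ z.im} :=
  closure_minimal (fun z (h : 0 < z.im) => h.le)
    (isClosed_le continuous_const Complex.continuous_im)

/-- Maximum principle on the upper half-plane, for a function that converges at infinity. -/
lemma norm_le_one_of_norm_le_one_on_real {f : ℂ → ℂ}
    (hd : DifferentiableOn ℂ f {z | 0 < z.im}) (hc : ContinuousOn f {z | 0 ≤ z.im})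
    (hl : Tendsto f (cobounded ℂ ⊓ 𝓟 {z | 0 ≤ z.im}) (𝓝 1))
    (hr : ∀ k : ℝ, ‖f k‖ ≤ 1) {z : ℂ} (hz : 0 ≤ z.im) : ‖f z‖ ≤ 1 := by
  apply le_of_forall_pos_le_add
  intro δ hδ
  have h1 : ∀ᶠ y in cobounded ℂ ⊓ 𝓟 {z | 0 ≤ z.im}, ‖f y‖ ≤ 1 + δ := by
    have : Tendsto (fun y => ‖f y‖) (cobounded ℂ ⊓ 𝓟 {z | 0 ≤ z.im}) (𝓝 1) := by
      simpa using hl.norm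
    exact (this.eventually_lt_const (by linarith : (1 : ℝ) < 1 + δ)).mono fun _ h => h.le
  rw [eventually_inf_principal, ← comap_norm_atTop, eventually_comap] at h1
  obtain ⟨R, hR⟩ := eventually_atTop.1 h1
  set U : Set ℂ := {z | 0 < z.im} ∩ Metric.ball 0 (max R (‖z‖ + 1)) with hU
  have hUo : IsOpen U :=
    (isOpen_lt continuous_const Complex.continuous_im).inter Metric.isOpen_ball
  have hcl : closure U ⊆ {z | 0 ≤ z.im} :=
    (closure_mono Set.inter_subset_left).trans closure_upper_subset
  by_cases hz0 : z.im = 0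
  · have : z = (z.re : ℂ) := Complex.ext rfl (by simpa using hz0)
    rw [this]
    linarith [hr z.re]
  refine Complex.norm_le_of_forall_mem_frontier_norm_le (U := U)
    (Metric.isBounded_ball.subset Set.inter_subset_right)
    ⟨hd.mono Set.inter_subset_left, hc.mono hcl⟩ ?_
    (subset_closure ⟨lt_of_le_of_ne hz (Ne.symm hz0), by simp⟩)
  intro y hy
  have hy1 : 0 ≤ y.im := hcl hy.1
  have hy2 : y ∉ U := by
    have := hy.2
    rwa [hUo.interior_eq] at this
  by_cases hy0 : y.im = 0
  · have : y = (y.re : ℂ) := Complex.ext rfl (by simpa using hy0)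
    rw [this]
    linarith [hr y.re]
  · have hyR : max R (‖z‖ + 1) ≤ ‖y‖ := by
      by_contra! h
      exact hy2 ⟨lt_of_le_of_ne hy1 (Ne.symm hy0), by simpa using h⟩
    exact hR ‖y‖ ((le_max_left _ _).trans hyR) y rfl hy1

/-- A holomorphic function on the upper half-plane that vanishes at infinity and is purely
imaginary on the real line vanishes: the maximum principle applied to `exp (± g)` shows that the
real part of `g` is zero, so `g` is constant. -/
lemma eq_zero_of_re_eq_zero_on_real {g : ℂ → ℂ}
    (hd : DifferentiableOn ℂ g {z | 0 < z.im}) (hc : ContinuousOn g {z | 0 ≤ z.im})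
    (hl : Tendsto g (cobounded ℂ ⊓ 𝓟 {z | 0 ≤ z.im}) (𝓝 0))
    (hr : ∀ k : ℝ, (g k).re = 0) {z : ℂ} (hz : 0 ≤ z.im) : g z = 0 := by
  have hre : ∀ y : ℂ, 0 ≤ y.im → (g y).re = 0 := by
    have key : ∀ s : ℝ, ∀ y : ℂ, 0 ≤ y.im → ‖Complex.exp (s * g y)‖ ≤ 1 := by
      intro s y hy
      refine norm_le_one_of_norm_le_one_on_real (f := fun y => Complex.exp (s * g y))
        ((hd.const_mul _).cexp) ((continuousOn_const.mul hc).cexp) ?_ ?_ hy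
      · have := (Complex.continuous_exp.tendsto _).comp (hl.const_mul (s : ℂ))
        simpa [Function.comp_def] using this
      · intro k
        simp [Complex.norm_exp, hr k]
    intro y hy
    have h1 := key 1 y hy
    have h2 := key (-1) y hy
    simp only [Complex.norm_exp, Real.exp_le_one_iff] at h1 h2
    simp at h1 h2
    linarith
  have hopen : IsOpen {z : ℂ | 0 < z.im} := isOpen_lt continuous_const Complex.continuous_im
  -- a holomorphic function with vanishing real part has vanishing derivative
  have hderiv : Set.EqOn (deriv g) 0 {z | 0 < z.im} := by
    intro y hy
    have hg : HasDerivAt g (deriv g y) y := (hd.differentiableAt (hopen.mem_nhds hy)).hasDerivAt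
    have hdir : ∀ v : ℂ, (v * deriv g y).re = 0 := by
      intro v
      have h1 : HasDerivAt (fun s : ℝ => y + s * v) v 0 := by
        simpa using ((Complex.ofRealCLM.hasDerivAt (x := 0)).mul_const v).const_add y
      have h2 : HasDerivAt (fun s : ℝ => g (y + s * v)) (deriv g y * v) 0 := by
        have hg' : HasDerivAt g (deriv g y) (y + ((0 : ℝ) : ℂ) * v) := by simpa using hg
        exact HasDerivAt.comp (0 : ℝ) hg' h1
      have h3 : HasDerivAt (fun s : ℝ => (g (y + s * v)).re) (deriv g y * v).re 0 :=
        Complex.reCLM.hasFDerivAt.comp_hasDerivAt (0 : ℝ) h2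
      have h4 : (fun s : ℝ => (g (y + s * v)).re) =ᶠ[𝓝 0] fun _ => 0 := by
        have : Tendsto (fun s : ℝ => y + s * v) (𝓝 0) (𝓝 y) := by
          simpa using h1.continuousAt.tendsto
        filter_upwards [this.eventually (hopen.mem_nhds hy)] with s hs
        exact hre _ (le_of_lt hs)
      rw [mul_comm]
      exact h3.unique ((hasDerivAt_const (0 : ℝ) (0 : ℝ)).congr_of_eventuallyEq h4)
    have h1 := hdir 1
    have h2 := hdir Complex.I
    simp at h1 h2
    exact Complex.ext h1 h2
  have hconst : ∀ y : ℂ, 0 < y.im → g y = g Complex.I := fun y hy =>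
    hopen.is_const_of_deriv_eq_zero (convex_halfSpace_im_gt 0).isPreconnected hd hderiv hy
      (by simp : 0 < Complex.I.im)
  have hpath : ∀ s : ℝ, 0 < s → g (z + s * Complex.I) = g Complex.I := fun s hs =>
    hconst _ (by simpa using by linarith)
  have hmem : ∀ s : ℝ, 0 < s → z + s * Complex.I ∈ {z : ℂ | 0 ≤ z.im} := fun s hs => by
    simpa using by linarith
  have hinf : g Complex.I = 0 := by
    have h1 : Tendsto (fun s : ℝ => z + s * Complex.I) atTop
        (cobounded ℂ ⊓ 𝓟 {z | 0 ≤ z.im}) := by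
      refine tendsto_inf.2 ⟨?_, tendsto_principal.2 ?_⟩
      · rw [← tendsto_norm_atTop_iff_cobounded]
        refine tendsto_atTop_mono (fun s => ?_) tendsto_id
        calc s ≤ z.im + s := by linarith
          _ = (z + s * Complex.I).im := by simp
          _ ≤ _ := (le_abs_self _).trans (Complex.abs_im_le_norm _)
      · exact (eventually_gt_atTop 0).mono hmem
    refine tendsto_nhds_unique (tendsto_const_nhds.congr' ?_) (hl.comp h1)
    exact (eventually_gt_atTop 0).mono fun s hs => (hpath s hs).symm
  rw [← hinf]
  have h1 : Tendsto (fun s : ℝ => z + s * Complex.I) (𝓝[>] 0) (𝓝[{z | 0 ≤ z.im}] z) := by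
    refine tendsto_nhdsWithin_iff.2 ⟨?_, eventually_nhdsWithin_of_forall hmem⟩
    have : Continuous fun s : ℝ => z + s * Complex.I := by fun_prop
    simpa using (this.tendsto 0).mono_left nhdsWithin_le_nhds
  refine tendsto_nhds_unique ((hc z hz).tendsto.comp h1) (tendsto_const_nhds.congr' ?_)
  exact eventually_nhdsWithin_of_forall fun s hs => (hpath s hs).symm

/-- Liouville's theorem for a function given on the two closed half-planes, with matching values
on the real line. With `h⋆ z = conj (h (conj z))`, the functions `f - h⋆` and `i (f + h⋆)`,
normalized at infinity, are purely imaginary on the real line. -/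
lemma eq_const_of_eq_on_real {f h : ℂ → ℂ} {c : ℂ}
    (hdf : DifferentiableOn ℂ f {z | 0 < z.im}) (hcf : ContinuousOn f {z | 0 ≤ z.im})
    (hlf : Tendsto f (cobounded ℂ ⊓ 𝓟 {z | 0 ≤ z.im}) (𝓝 c))
    (hdh : DifferentiableOn ℂ h {z | z.im < 0}) (hch : ContinuousOn h {z | z.im ≤ 0})
    (hlh : Tendsto h (cobounded ℂ ⊓ 𝓟 {z | z.im ≤ 0}) (𝓝 c))
    (hr : ∀ k : ℝ, f k = h k) :
    (∀ z : ℂ, 0 ≤ z.im → f z = c) ∧ (∀ z : ℂ, z.im ≤ 0 → h z = c) := by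
  set F : ℂ → ℂ := fun z => f z - c with hF
  set H : ℂ → ℂ := fun z => conj (h (conj z)) - conj c with hH
  have hdF : DifferentiableOn ℂ F {z | 0 < z.im} := hdf.sub_const c
  have hcF : ContinuousOn F {z | 0 ≤ z.im} := hcf.sub continuousOn_const
  have hlF : Tendsto F (cobounded ℂ ⊓ 𝓟 {z | 0 ≤ z.im}) (𝓝 0) := by
    simpa using hlf.sub_const c
  have hdH : DifferentiableOn ℂ H {z | 0 < z.im} := by
    intro z hz
    have hz' : (conj z).im < 0 := by simpa using hz
    have : DifferentiableAt ℂ h (conj z) := hdh.differentiableAt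
      ((isOpen_lt Complex.continuous_im continuous_const).mem_nhds hz')
    have := this.conj_conj
    rw [Complex.conj_conj] at this
    exact (this.sub_const _).differentiableWithinAt
  have hcH : ContinuousOn H {z | 0 ≤ z.im} := by
    refine ContinuousOn.sub (Complex.continuous_conj.comp_continuousOn
      (hch.comp Complex.continuous_conj.continuousOn ?_)) continuousOn_const
    intro z hz
    simpa using hz
  have hlH : Tendsto H (cobounded ℂ ⊓ 𝓟 {z | 0 ≤ z.im}) (𝓝 0) := by
    have h1 : Tendsto (fun z : ℂ => conj z) (cobounded ℂ ⊓ 𝓟 {z | 0 ≤ z.im})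
        (cobounded ℂ ⊓ 𝓟 {z | z.im ≤ 0}) := by
      refine tendsto_inf.2 ⟨?_, tendsto_principal.2 ?_⟩
      · refine Tendsto.mono_left ?_ inf_le_left
        rw [← tendsto_norm_atTop_iff_cobounded]
        simpa using tendsto_norm_cobounded_atTop
      · exact mem_inf_of_right (by intro z hz; simpa using hz)
    have h2 := ((Complex.continuous_conj.tendsto c).comp (hlh.comp h1)).sub_const (conj c)
    simpa [hH, Function.comp_def] using h2
  have hreal : ∀ k : ℝ, H k = conj (F k) := by
    intro k
    simp [hH, hF, hr k]
  have hminus : ∀ z : ℂ, 0 ≤ z.im → F z - H z = 0 := fun z hz =>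
    eq_zero_of_re_eq_zero_on_real (g := fun z => F z - H z) (hdF.sub hdH) (hcF.sub hcH)
      (by simpa using hlF.sub hlH) (fun k => by simp [hreal k]) hz
  have hplus : ∀ z : ℂ, 0 ≤ z.im → Complex.I * (F z + H z) = 0 := fun z hz =>
    eq_zero_of_re_eq_zero_on_real (g := fun z => Complex.I * (F z + H z))
      ((hdF.add hdH).const_mul _) (continuousOn_const.mul (hcF.add hcH))
      (by simpa using (hlF.add hlH).const_mul Complex.I) (fun k => by simp [hreal k]) hz
  have hboth : ∀ z : ℂ, 0 ≤ z.im → F z = 0 ∧ H z = 0 := by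
    intro z hz
    have h1 := hminus z hz
    have h2 := (mul_eq_zero.1 (hplus z hz)).resolve_left Complex.I_ne_zero
    exact ⟨by linear_combination (h1 + h2) / 2, by linear_combination (h2 - h1) / 2⟩
  refine ⟨fun z hz => sub_eq_zero.1 (hboth z hz).1, fun z hz => ?_⟩
  have h1 := (hboth (conj z) (by simpa using hz)).2
  have h2 := congrArg conj h1
  simpa [hH, sub_eq_zero] using h2

/-! ### Regularity of determinants and inverses -/

lemma contDiff_det {𝕜 : Type*} [NontriviallyNormedField 𝕜] {F : Type*} [NormedField F]
    [NormedAlgebra 𝕜 F] {n : Type*} [Fintype n] [DecidableEq n] {m : WithTop ℕ∞}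
    {E : Type*} [NormedAddCommGroup E] [NormedSpace 𝕜 E] {A : E → Matrix n n F}
    (hA : ∀ i j, ContDiff 𝕜 m fun z => A z i j) : ContDiff 𝕜 m fun z => (A z).det := by
  simp only [Matrix.det_apply]
  exact ContDiff.sum fun σ _ => (contDiff_prod fun i _ => hA _ _).const_smul _

lemma contDiff_adjugate {𝕜 : Type*} [NontriviallyNormedField 𝕜] {F : Type*} [NormedField F]
    [NormedAlgebra 𝕜 F] {n : Type*} [Fintype n] [DecidableEq n] {m : WithTop ℕ∞}
    {E : Type*} [NormedAddCommGroup E] [NormedSpace 𝕜 E] {A : E → Matrix n n F}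
    (hA : ∀ i j, ContDiff 𝕜 m fun z => A z i j) (i j : n) :
    ContDiff 𝕜 m fun z => (A z).adjugate i j := by
  simp only [Matrix.adjugate_apply]
  refine contDiff_det fun k l => ?_
  by_cases h : k = j
  · subst h
    simpa using contDiff_const
  · simpa [updateRow_apply, h] using hA k l

lemma contDiff_inv {𝕜 : Type*} [NontriviallyNormedField 𝕜] {F : Type*} [NormedField F]
    [NormedAlgebra 𝕜 F] {n : Type*} [Fintype n] [DecidableEq n] {m : WithTop ℕ∞}
    {E : Type*} [NormedAddCommGroup E] [NormedSpace 𝕜 E] {A : E → Matrix n n F}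
    (hA : ∀ i j, ContDiff 𝕜 m fun z => A z i j) (hu : ∀ z, IsUnit (A z).det) (i j : n) :
    ContDiff 𝕜 m fun z => (A z)⁻¹ i j := by
  simp only [Matrix.inv_def, Ring.inverse_eq_inv', Matrix.smul_apply, smul_eq_mul]
  exact ((contDiff_det hA).inv fun z => (hu z).ne_zero).mul (contDiff_adjugate hA i j)

lemma differentiableOn_det {A : ℂ → Matrix (Fin 4) (Fin 4) ℂ} {s : Set ℂ}
    (hA : ∀ i j, DifferentiableOn ℂ (fun z => A z i j) s) :
    DifferentiableOn ℂ (fun z => (A z).det) s := by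
  have h : ContDiff ℂ 1 fun B : Fin 4 → Fin 4 → ℂ => (Matrix.of B).det :=
    contDiff_det fun i j => by simpa using contDiff_apply_apply ℂ ℂ i j
  exact (h.differentiable one_ne_zero).comp_differentiableOn
    (differentiableOn_pi.2 fun i => differentiableOn_pi.2 fun j => hA i j)

lemma differentiableOn_inv {A : ℂ → Matrix (Fin 4) (Fin 4) ℂ} {s : Set ℂ}
    (hA : ∀ i j, DifferentiableOn ℂ (fun z => A z i j) s) (hu : ∀ z ∈ s, (A z).det ≠ 0)
    (i j : Fin 4) : DifferentiableOn ℂ (fun z => (A z)⁻¹ i j) s := by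
  simp only [Matrix.inv_def, Ring.inverse_eq_inv', Matrix.smul_apply, smul_eq_mul]
  have h : ContDiff ℂ 1 fun B : Fin 4 → Fin 4 → ℂ => (Matrix.of B).adjugate i j :=
    contDiff_adjugate (fun i j => by simpa using contDiff_apply_apply ℂ ℂ i j) i j
  exact ((differentiableOn_det hA).inv hu).mul ((h.differentiable one_ne_zero).comp_differentiableOn
    (differentiableOn_pi.2 fun i => differentiableOn_pi.2 fun j => hA i j))

lemma continuousOn_matrix_inv {A : ℂ → Matrix (Fin 4) (Fin 4) ℂ} {s : Set ℂ}
    (hA : ContinuousOn A s) (hu : ∀ z ∈ s, (A z).det ≠ 0) :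
    ContinuousOn (fun z => (A z)⁻¹) s := by
  simp only [Matrix.inv_def, Ring.inverse_eq_inv']
  exact (((continuous_id.matrix_det.comp_continuousOn hA)).inv₀ hu).smul
    (continuous_id.matrix_adjugate.comp_continuousOn hA)

lemma tendsto_matrix_inv {n : Type*} [Fintype n] [DecidableEq n] {α : Type*} {l : Filter α}
    {A : α → Matrix n n ℂ} {B : Matrix n n ℂ} (hB : B.det ≠ 0) (hA : Tendsto A l (𝓝 B)) :
    Tendsto (fun z => (A z)⁻¹) l (𝓝 B⁻¹) := by
  simp only [Matrix.inv_def, Ring.inverse_eq_inv']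
  exact (((continuous_id.matrix_det.tendsto _).comp hA).inv₀ hB).smul
    ((continuous_id.matrix_adjugate.tendsto _).comp hA)

/-! ### Existence for the Riemann-Hilbert problem -/

section RH

variable {N : ℕ} {lam : Fin N → ℂ} {w : Fin N → Fin 4 → ℂ}

lemma rhUpper_apply (z : ℂ) (a b : Fin 4) : rhUpper lam w z a b =
    (1 : Matrix (Fin 4) (Fin 4) ℂ) a b - ∑ k, ∑ j, (gramMatrix lam w)⁻¹ k j *
      (z - conj (lam j))⁻¹ * (w k a * conj (w j b)) := by
  simp [rhUpper, Matrix.sum_apply, vecMulVec_apply, div_eq_mul_inv]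

lemma rhLower_apply (z : ℂ) (a b : Fin 4) : rhLower lam w z a b =
    (1 : Matrix (Fin 4) (Fin 4) ℂ) a b + ∑ k, ∑ j, (gramMatrix lam w)⁻¹ k j *
      (z - lam k)⁻¹ * (w k a * conj (w j b)) := by
  simp [rhLower, Matrix.sum_apply, vecMulVec_apply, div_eq_mul_inv]

lemma differentiableAt_inv_sub {c z : ℂ} (h : z - c ≠ 0) :
    DifferentiableAt ℂ (fun y => (y - c)⁻¹) z :=
  DifferentiableAt.fun_inv (differentiableAt_id.sub_const c) h

lemma differentiableAt_rhUpper {z : ℂ} (hz : ∀ j, z - conj (lam j) ≠ 0) (a b : Fin 4) :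
    DifferentiableAt ℂ (fun z => rhUpper lam w z a b) z := by
  simp only [rhUpper_apply]
  refine (DifferentiableAt.fun_sum fun k _ => DifferentiableAt.fun_sum fun j _ => ?_).const_sub _
  exact ((differentiableAt_inv_sub (hz j)).const_mul _).mul_const _

lemma differentiableAt_rhLower {z : ℂ} (hz : ∀ j, z - lam j ≠ 0) (a b : Fin 4) :
    DifferentiableAt ℂ (fun z => rhLower lam w z a b) z := by
  simp only [rhLower_apply]
  refine (DifferentiableAt.fun_sum fun k _ => DifferentiableAt.fun_sum fun j _ => ?_).const_add _
  exact ((differentiableAt_inv_sub (hz k)).const_mul _).mul_const _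

lemma continuousAt_matrix {X : Type*} [TopologicalSpace X] {A : X → Matrix (Fin 4) (Fin 4) ℂ}
    {x : X} (h : ∀ a b, ContinuousAt (fun z => A z a b) x) : ContinuousAt A x :=
  tendsto_pi_nhds.2 fun a => tendsto_pi_nhds.2 fun b => h a b

lemma continuousOn_matrix {X : Type*} [TopologicalSpace X] {A : X → Matrix (Fin 4) (Fin 4) ℂ}
    {s : Set X} (h : ∀ a b, ContinuousOn (fun z => A z a b) s) : ContinuousOn A s :=
  fun x hx => tendsto_pi_nhds.2 fun a => tendsto_pi_nhds.2 fun b => h a b x hx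

lemma tendsto_matrix {X : Type*} {l : Filter X} {A : X → Matrix (Fin 4) (Fin 4) ℂ}
    {B : Matrix (Fin 4) (Fin 4) ℂ} (h : ∀ a b, Tendsto (fun z => A z a b) l (𝓝 (B a b))) :
    Tendsto A l (𝓝 B) :=
  tendsto_pi_nhds.2 fun a => tendsto_pi_nhds.2 fun b => h a b

lemma tendsto_entry {X : Type*} {l : Filter X} {m n : Type*} {A : X → Matrix m n ℂ}
    {B : Matrix m n ℂ} (h : Tendsto A l (𝓝 B)) (a : m) (b : n) :
    Tendsto (fun z => A z a b) l (𝓝 (B a b)) :=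
  tendsto_pi_nhds.1 (tendsto_pi_nhds.1 h a) b

lemma continuousOn_entry {A : ℂ → Matrix (Fin 4) (Fin 4) ℂ} {s : Set ℂ} (h : ContinuousOn A s)
    (a b : Fin 4) : ContinuousOn (fun z => A z a b) s :=
  fun x hx => tendsto_entry (h x hx) a b

lemma tendsto_inv_sub_cobounded (c : ℂ) :
    Tendsto (fun z : ℂ => (z - c)⁻¹) (cobounded ℂ) (𝓝 0) :=
  tendsto_inv₀_cobounded.comp (tendsto_sub_const_cobounded c)

lemma tendsto_rhUpper : Tendsto (rhUpper lam w) (cobounded ℂ) (𝓝 1) := by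
  refine tendsto_matrix fun a b => ?_
  simp only [rhUpper_apply]
  have : Tendsto (fun z : ℂ => ∑ k, ∑ j, (gramMatrix lam w)⁻¹ k j *
      (z - conj (lam j))⁻¹ * (w k a * conj (w j b))) (cobounded ℂ) (𝓝 0) := by
    rw [show (0 : ℂ) = ∑ k, ∑ j, (gramMatrix lam w)⁻¹ k j * 0 * (w k a * conj (w j b)) by simp]
    exact tendsto_finsetSum _ fun k _ => tendsto_finsetSum _ fun j _ =>
      ((tendsto_inv_sub_cobounded _).const_mul _).mul_const _
  simpa using this.const_sub ((1 : Matrix (Fin 4) (Fin 4) ℂ) a b)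

lemma tendsto_rhLower : Tendsto (rhLower lam w) (cobounded ℂ) (𝓝 1) := by
  refine tendsto_matrix fun a b => ?_
  simp only [rhLower_apply]
  have : Tendsto (fun z : ℂ => ∑ k, ∑ j, (gramMatrix lam w)⁻¹ k j *
      (z - lam k)⁻¹ * (w k a * conj (w j b))) (cobounded ℂ) (𝓝 0) := by
    rw [show (0 : ℂ) = ∑ k, ∑ j, (gramMatrix lam w)⁻¹ k j * 0 * (w k a * conj (w j b)) by simp]
    exact tendsto_finsetSum _ fun k _ => tendsto_finsetSum _ fun j _ =>
      ((tendsto_inv_sub_cobounded _).const_mul _).mul_const _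
  simpa using this.const_add ((1 : Matrix (Fin 4) (Fin 4) ℂ) a b)

/-- The potential reconstructed from the `1 / z` term of `rhUpper`. -/
lemma tendsto_mul_rhUpper {a b : Fin 4} (hab : a ≠ b) :
    Tendsto (fun z => z * rhUpper lam w z a b) (cobounded ℂ)
      (𝓝 (-∑ k, ∑ j, (gramMatrix lam w)⁻¹ k j * (w k a * conj (w j b)))) := by
  have h1 : ∀ c : ℂ, Tendsto (fun z : ℂ => z * (z - c)⁻¹) (cobounded ℂ) (𝓝 1) := by
    intro c
    have h2 := ((tendsto_inv_sub_cobounded c).const_mul c).const_add 1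
    rw [mul_zero, add_zero] at h2
    refine h2.congr' ?_
    filter_upwards [eventually_ne_cobounded c] with z hz
    have := sub_ne_zero.2 hz
    field_simp
    ring
  have h2 : ∀ z, z * rhUpper lam w z a b = -∑ k, ∑ j, (gramMatrix lam w)⁻¹ k j *
      (z * (z - conj (lam j))⁻¹) * (w k a * conj (w j b)) := by
    intro z
    rw [rhUpper_apply, one_apply_ne hab, zero_sub, mul_neg, Finset.mul_sum]
    congr 1
    refine Finset.sum_congr rfl fun k _ => ?_
    rw [Finset.mul_sum]
    exact Finset.sum_congr rfl fun j _ => by ring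
  simp only [h2]
  rw [show ∑ k, ∑ j, (gramMatrix lam w)⁻¹ k j * (w k a * conj (w j b)) =
    ∑ k, ∑ j, (gramMatrix lam w)⁻¹ k j * 1 * (w k a * conj (w j b)) by simp]
  exact (tendsto_finsetSum _ fun k _ => tendsto_finsetSum _ fun j _ =>
      ((h1 _).const_mul _).mul_const _).neg

/-- A Blaschke-type product has simple zeros. -/
lemma deriv_prod_sub_div_ne_zero {a b : Fin N → ℂ} (ha : Function.Injective a) (j : Fin N)
    (hab : ∀ i, a j - b i ≠ 0) {f : ℂ → ℂ}
    (hf : f =ᶠ[𝓝 (a j)] fun z => ∏ i, (z - a i) / (z - b i)) : deriv f (a j) ≠ 0 := by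
  rw [hf.deriv_eq]
  set φ : ℂ → ℂ := fun z => (z - b j)⁻¹ * ∏ i ∈ Finset.univ.erase j, (z - a i) / (z - b i) with hφ
  have h1 : (fun z => ∏ i, (z - a i) / (z - b i)) = fun z => (z - a j) * φ z := by
    ext z
    rw [← Finset.mul_prod_erase _ _ (Finset.mem_univ j), hφ, div_eq_mul_inv, mul_assoc]
  have h2 : DifferentiableAt ℂ φ (a j) := by
    refine (differentiableAt_inv_sub (hab j)).fun_mul
      (DifferentiableAt.fun_finsetProd fun i _ => ?_)
    exact (differentiableAt_id.sub_const _).div (differentiableAt_id.sub_const _) (hab i)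
  have h3 : HasDerivAt (fun z => (z - a j) * φ z) (φ (a j)) (a j) := by
    simpa using ((hasDerivAt_id (a j)).sub_const (a j)).fun_mul h2.hasDerivAt
  rw [h1, h3.deriv, hφ]
  refine mul_ne_zero (inv_ne_zero (hab j)) (Finset.prod_ne_zero_iff.2 fun i hi => ?_)
  refine div_ne_zero (sub_ne_zero.2 fun h => ?_) (hab i)
  exact (Finset.mem_erase.1 hi).1 (ha h).symm

lemma isOpen_upper : IsOpen {z : ℂ | 0 < z.im} := isOpen_lt continuous_const Complex.continuous_im

lemma isOpen_lower : IsOpen {z : ℂ | z.im < 0} := isOpen_lt Complex.continuous_im continuous_const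

theorem isRHSolution_rational (hlam : Function.Injective lam) (him : ∀ j, 0 < (lam j).im)
    (hw : ∀ j, w j ≠ 0) : IsRHSolution lam w (rhUpper lam w) (rhLower lam w) where
  analytic₁ a b z hz := (differentiableAt_rhUpper
    (sub_conj_ne_zero_of_im_nonneg him (le_of_lt hz)) a b).differentiableWithinAt
  continuous₁ z hz := (continuousAt_matrix fun a b => (differentiableAt_rhUpper
    (sub_conj_ne_zero_of_im_nonneg him hz) a b).continuousAt).continuousWithinAt
  analytic₂ a b z hz := (differentiableAt_rhLower
    (sub_ne_zero_of_im_nonpos him (le_of_lt hz)) a b).differentiableWithinAt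
  continuous₂ z hz := (continuousAt_matrix fun a b => (differentiableAt_rhLower
    (sub_ne_zero_of_im_nonpos him hz) a b).continuousAt).continuousWithinAt
  jump k := rhLower_mul_rhUpper hlam him hw (sub_ne_zero_of_im_nonpos him (by simp))
    (sub_conj_ne_zero_of_im_nonneg him (by simp))
  normalized₁ := tendsto_rhUpper.mono_left inf_le_left
  normalized₂ := tendsto_rhLower.mono_left inf_le_left
  zeros₁ z hz := by
    have h := sub_conj_ne_zero_of_im_nonneg him hz.le
    rw [rhUpper_det hlam him hw h]
    simp [Finset.prod_eq_zero_iff, h, sub_eq_zero (a := z) (b := lam _)]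
  simple₁ j := by
    refine deriv_prod_sub_div_ne_zero hlam j (fun i => sub_conj_ne_zero (him i) (him j)) ?_
    filter_upwards [isOpen_upper.mem_nhds (him j)] with z hz
    exact rhUpper_det hlam him hw (sub_conj_ne_zero_of_im_nonneg him (le_of_lt hz))
  zeros₂ z hz := by
    have h := sub_ne_zero_of_im_nonpos him hz.le
    rw [rhLower_det hlam him hw h]
    simp [Finset.prod_eq_zero_iff, h, sub_eq_zero (a := z) (b := conj (lam _))]
  simple₂ j := by
    have hj : (conj (lam j)).im < 0 := by simpa using him j
    refine deriv_prod_sub_div_ne_zero (a := fun j => conj (lam j))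
      (fun i j h => hlam ((starRingEnd ℂ).injective h)) j
      (sub_ne_zero_of_im_nonpos him hj.le) ?_
    filter_upwards [isOpen_lower.mem_nhds hj] with z hz
    exact rhLower_det hlam him hw (sub_ne_zero_of_im_nonpos him (le_of_lt hz))
  kernel₁ := rhUpper_kernel hlam him hw
  kernel₂ := rhLower_kernel hlam him hw

end RH

/-! ### Uniqueness for the Riemann-Hilbert problem -/

section Unique

variable {N : ℕ} {lam : Fin N → ℂ} {w : Fin N → Fin 4 → ℂ}
  {P₁ P₂ : ℂ → Matrix (Fin 4) (Fin 4) ℂ}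

/-- The holomorphic extension of `P₁ * rhLower` across the poles `λ_k`, which are removable since
`P₁ (λ_k) w_k = 0`. -/
noncomputable def upperRatio (lam : Fin N → ℂ) (w : Fin N → Fin 4 → ℂ)
    (P₁ : ℂ → Matrix (Fin 4) (Fin 4) ℂ) (z : ℂ) : Matrix (Fin 4) (Fin 4) ℂ :=
  Matrix.of fun a b => P₁ z a b + ∑ k, ∑ j, (gramMatrix lam w)⁻¹ k j *
    dslope (fun y => (P₁ y *ᵥ w k) a) (lam k) z * conj (w j b)

/-- The holomorphic extension of `rhUpper * P₂` across the poles `λ_j^*`, which are removable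
since `ŵ_j P₂ (λ_j^*) = 0`. -/
noncomputable def lowerRatio (lam : Fin N → ℂ) (w : Fin N → Fin 4 → ℂ)
    (P₂ : ℂ → Matrix (Fin 4) (Fin 4) ℂ) (z : ℂ) : Matrix (Fin 4) (Fin 4) ℂ :=
  Matrix.of fun a b => P₂ z a b - ∑ k, ∑ j, (gramMatrix lam w)⁻¹ k j *
    w k a * dslope (fun y => (star (w j) ᵥ* P₂ y) b) (conj (lam j)) z

lemma dslope_of_root {f : ℂ → ℂ} {c z : ℂ} (hc : f c = 0) (hz : z - c ≠ 0) :
    dslope f c z = (z - c)⁻¹ * f z := by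
  rw [dslope_of_ne _ (sub_ne_zero.1 hz), slope_def_field, hc, sub_zero, div_eq_inv_mul]

lemma upperRatio_eq (h : IsRHSolution lam w P₁ P₂) {z : ℂ} (hz : ∀ k, z - lam k ≠ 0) :
    upperRatio lam w P₁ z = P₁ z * rhLower lam w z := by
  ext a b
  have h0 : ∀ k, dslope (fun y => (P₁ y *ᵥ w k) a) (lam k) z
      = (z - lam k)⁻¹ * (P₁ z *ᵥ w k) a :=
    fun k => dslope_of_root (congrFun (h.kernel₁ k) a) (hz k)
  simp only [upperRatio, of_apply, Matrix.mul_apply, rhLower_apply, mul_add, Finset.sum_add_distrib]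
  congr 1
  · rw [← Matrix.mul_apply, Matrix.mul_one]
  · simp only [h0]
    simp only [mulVec, dotProduct, Finset.mul_sum, Finset.sum_mul]
    rw [Finset.sum_comm (s := (Finset.univ : Finset (Fin 4)))]
    refine Finset.sum_congr rfl fun k _ => ?_
    rw [Finset.sum_comm (s := (Finset.univ : Finset (Fin 4)))]
    exact Finset.sum_congr rfl fun j _ => Finset.sum_congr rfl fun x _ => by ring

lemma lowerRatio_eq (h : IsRHSolution lam w P₁ P₂) {z : ℂ} (hz : ∀ j, z - conj (lam j) ≠ 0) :
    lowerRatio lam w P₂ z = rhUpper lam w z * P₂ z := by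
  ext a b
  have h0 : ∀ j, dslope (fun y => (star (w j) ᵥ* P₂ y) b) (conj (lam j)) z
      = (z - conj (lam j))⁻¹ * (star (w j) ᵥ* P₂ z) b :=
    fun j => dslope_of_root (congrFun (h.kernel₂ j) b) (hz j)
  simp only [lowerRatio, of_apply, Matrix.mul_apply, rhUpper_apply, sub_mul,
    Finset.sum_sub_distrib]
  congr 1
  · rw [← Matrix.mul_apply, Matrix.one_mul]
  · simp only [h0]
    simp only [vecMul, dotProduct, Finset.mul_sum, Finset.sum_mul]
    rw [Finset.sum_comm (s := (Finset.univ : Finset (Fin 4)))]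
    refine Finset.sum_congr rfl fun k _ => ?_
    rw [Finset.sum_comm (s := (Finset.univ : Finset (Fin 4)))]
    refine Finset.sum_congr rfl fun j _ => Finset.sum_congr rfl fun x _ => ?_
    rw [Pi.star_apply, show star (w j x) = conj (w j x) from rfl]
    ring

lemma differentiableOn_mulVec_entry
    (hA : ∀ a b, DifferentiableOn ℂ (fun z => P₁ z a b) {z | 0 < z.im})
    (v : Fin 4 → ℂ) (a : Fin 4) :
    DifferentiableOn ℂ (fun z => (P₁ z *ᵥ v) a) {z | 0 < z.im} := by
  simp only [mulVec, dotProduct]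
  exact DifferentiableOn.fun_sum fun b _ => (hA a b).mul_const _

lemma differentiableOn_vecMul_entry
    (hA : ∀ a b, DifferentiableOn ℂ (fun z => P₂ z a b) {z | z.im < 0})
    (v : Fin 4 → ℂ) (b : Fin 4) :
    DifferentiableOn ℂ (fun z => (v ᵥ* P₂ z) b) {z | z.im < 0} := by
  simp only [vecMul, dotProduct]
  exact DifferentiableOn.fun_sum fun a _ => (hA a b).const_mul _

lemma differentiableOn_upperRatio (him : ∀ j, 0 < (lam j).im) (h : IsRHSolution lam w P₁ P₂)
    (a b : Fin 4) : DifferentiableOn ℂ (fun z => upperRatio lam w P₁ z a b) {z | 0 < z.im} := by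
  simp only [upperRatio, of_apply]
  refine (h.analytic₁ a b).add (DifferentiableOn.fun_sum fun k _ => DifferentiableOn.fun_sum
    fun j _ => (DifferentiableOn.const_mul ?_ _).mul_const _)
  exact (Complex.differentiableOn_dslope (isOpen_upper.mem_nhds (him k))).2
    (differentiableOn_mulVec_entry h.analytic₁ _ _)

lemma differentiableOn_lowerRatio (him : ∀ j, 0 < (lam j).im) (h : IsRHSolution lam w P₁ P₂)
    (a b : Fin 4) : DifferentiableOn ℂ (fun z => lowerRatio lam w P₂ z a b) {z | z.im < 0} := by
  simp only [lowerRatio, of_apply]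
  refine (h.analytic₂ a b).sub (DifferentiableOn.fun_sum fun k _ => DifferentiableOn.fun_sum
    fun j _ => (DifferentiableOn.const_mul ?_ _))
  exact (Complex.differentiableOn_dslope
    (isOpen_lower.mem_nhds (show (conj (lam j)).im < 0 by simpa using him j))).2
    (differentiableOn_vecMul_entry h.analytic₂ _ _)

lemma continuousOn_upperRatio (him : ∀ j, 0 < (lam j).im) (h : IsRHSolution lam w P₁ P₂) :
    ContinuousOn (upperRatio lam w P₁) {z | 0 ≤ z.im} := by
  refine continuousOn_matrix fun a b => ?_
  simp only [upperRatio, of_apply]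
  refine (continuousOn_entry h.continuous₁ a b).add (continuousOn_finsetSum _ fun k _ =>
    continuousOn_finsetSum _ fun j _ => (continuousOn_const.mul ?_).mul continuousOn_const)
  refine (continuousOn_dslope (mem_of_superset (isOpen_upper.mem_nhds (him k))
    fun z (hz : 0 < z.im) => hz.le)).2 ⟨?_,
    (differentiableOn_mulVec_entry h.analytic₁ _ _).differentiableAt
    (isOpen_upper.mem_nhds (him k))⟩
  simp only [mulVec, dotProduct]
  exact continuousOn_finsetSum _ fun b _ => (continuousOn_entry h.continuous₁ a b).mul
    continuousOn_const

lemma continuousOn_lowerRatio (him : ∀ j, 0 < (lam j).im) (h : IsRHSolution lam w P₁ P₂) :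
    ContinuousOn (lowerRatio lam w P₂) {z | z.im ≤ 0} := by
  refine continuousOn_matrix fun a b => ?_
  simp only [lowerRatio, of_apply]
  refine (continuousOn_entry h.continuous₂ a b).sub (continuousOn_finsetSum _ fun k _ =>
    continuousOn_finsetSum _ fun j _ => (continuousOn_const.mul ?_))
  have hj : (conj (lam j)).im < 0 := by simpa using him j
  refine (continuousOn_dslope (mem_of_superset (isOpen_lower.mem_nhds hj)
    fun z (hz : z.im < 0) => hz.le)).2 ⟨?_,
    (differentiableOn_vecMul_entry h.analytic₂ _ _).differentiableAt
    (isOpen_lower.mem_nhds hj)⟩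
  simp only [vecMul, dotProduct]
  exact continuousOn_finsetSum _ fun a _ => continuousOn_const.mul
    (continuousOn_entry h.continuous₂ a b)

lemma eventually_sub_ne_zero (c : Fin N → ℂ) : ∀ᶠ z in cobounded ℂ, ∀ k, z - c k ≠ 0 :=
  eventually_all.2 fun k => (eventually_ne_cobounded (c k)).mono fun _ h => sub_ne_zero.2 h

lemma eventually_nhdsNE_sub_ne_zero (c : Fin N → ℂ) (z₀ : ℂ) :
    ∀ᶠ z in 𝓝[≠] z₀, ∀ k, z - c k ≠ 0 := by
  refine eventually_all.2 fun k => ?_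
  by_cases h : c k = z₀
  · subst h
    exact eventually_nhdsWithin_of_forall fun z hz => sub_ne_zero.2 hz
  · exact (isOpen_ne.eventually_mem (Ne.symm h)).filter_mono nhdsWithin_le_nhds |>.mono
      fun z hz => sub_ne_zero.2 hz

lemma tendsto_upperRatio (h : IsRHSolution lam w P₁ P₂) :
    Tendsto (upperRatio lam w P₁) (cobounded ℂ ⊓ 𝓟 {z | 0 ≤ z.im}) (𝓝 1) := by
  have h1 := h.normalized₁.mul ((tendsto_rhLower (lam := lam) (w := w)).mono_left
    (inf_le_left (b := 𝓟 {z : ℂ | 0 ≤ z.im})))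
  rw [Matrix.one_mul] at h1
  refine h1.congr' ?_
  filter_upwards [(eventually_sub_ne_zero lam).filter_mono inf_le_left] with z hz
  exact (upperRatio_eq h hz).symm

lemma tendsto_lowerRatio (h : IsRHSolution lam w P₁ P₂) :
    Tendsto (lowerRatio lam w P₂) (cobounded ℂ ⊓ 𝓟 {z | z.im ≤ 0}) (𝓝 1) := by
  have h1 := ((tendsto_rhUpper (lam := lam) (w := w)).mono_left
    (inf_le_left (b := 𝓟 {z : ℂ | z.im ≤ 0}))).mul h.normalized₂
  rw [Matrix.one_mul] at h1
  refine h1.congr' ?_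
  filter_upwards [(eventually_sub_ne_zero fun j => conj (lam j)).filter_mono inf_le_left] with z hz
  exact (lowerRatio_eq h hz).symm

variable (hlam : Function.Injective lam) (him : ∀ j, 0 < (lam j).im) (hw : ∀ j, w j ≠ 0)
include hlam him hw

lemma lowerRatio_mul_upperRatio (h : IsRHSolution lam w P₁ P₂) (k : ℝ) :
    lowerRatio lam w P₂ k * upperRatio lam w P₁ k = 1 := by
  have h1 : ∀ j, (k : ℂ) - lam j ≠ 0 := sub_ne_zero_of_im_nonpos him (by simp)
  have h2 : ∀ j, (k : ℂ) - conj (lam j) ≠ 0 := sub_conj_ne_zero_of_im_nonneg him (by simp)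
  rw [lowerRatio_eq h h2, upperRatio_eq h h1, Matrix.mul_assoc, ← Matrix.mul_assoc (P₂ k), h.jump,
    Matrix.one_mul, mul_eq_one_comm]
  exact rhLower_mul_rhUpper hlam him hw h1 h2

/-- The zeros of `det P₂` are compensated by the poles of `rhUpper`; this uses that they are
simple. -/
lemma lowerRatio_det_ne_zero (h : IsRHSolution lam w P₁ P₂) {z : ℂ} (hz : z.im ≤ 0) :
    (lowerRatio lam w P₂ z).det ≠ 0 := by
  rcases hz.lt_or_eq with hz | hz
  swap
  · have h1 : z = (z.re : ℂ) := Complex.ext rfl (by simpa using hz)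
    rw [h1]
    have := congrArg det (lowerRatio_mul_upperRatio hlam him hw h z.re)
    rw [det_mul, det_one] at this
    exact left_ne_zero_of_mul_eq_one this
  have hdet : ∀ y : ℂ, y.im < 0 →
      (P₂ y).det = (rhLower lam w y).det * (lowerRatio lam w P₂ y).det := by
    intro y hy
    have hy1 := sub_ne_zero_of_im_nonpos him hy.le
    by_cases hy2 : ∃ j, y = conj (lam j)
    · rw [(h.zeros₂ y hy).2 hy2, ((isRHSolution_rational hlam him hw).zeros₂ y hy).2 hy2, zero_mul]
    · have hy3 : ∀ j, y - conj (lam j) ≠ 0 := fun j hj => hy2 ⟨j, sub_eq_zero.1 hj⟩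
      rw [lowerRatio_eq h hy3, ← det_mul, ← Matrix.mul_assoc,
        rhLower_mul_rhUpper hlam him hw hy1 hy3, Matrix.one_mul]
  by_cases hz2 : ∃ j, z = conj (lam j)
  · obtain ⟨j, rfl⟩ := hz2
    have hn := isOpen_lower.mem_nhds hz
    have hd1 : DifferentiableAt ℂ (fun y => (rhLower lam w y).det) (conj (lam j)) :=
      (differentiableOn_det (isRHSolution_rational hlam him hw).analytic₂).differentiableAt hn
    have hd2 : DifferentiableAt ℂ (fun y => (lowerRatio lam w P₂ y).det) (conj (lam j)) :=
      (differentiableOn_det (differentiableOn_lowerRatio him h)).differentiableAt hn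
    have hs := h.simple₂ j
    rw [EventuallyEq.deriv_eq (f := fun y => (rhLower lam w y).det * (lowerRatio lam w P₂ y).det)
      (mem_of_superset hn hdet), (hd1.hasDerivAt.fun_mul hd2.hasDerivAt).deriv,
      ((isRHSolution_rational hlam him hw).zeros₂ _ hz).2 ⟨j, rfl⟩, zero_mul, add_zero] at hs
    exact right_ne_zero_of_mul hs
  · have h1 : (P₂ z).det ≠ 0 := fun h0 => hz2 ((h.zeros₂ z hz).1 h0)
    rw [hdet z hz] at h1
    exact right_ne_zero_of_mul h1

/-- `upperRatio` and the inverse of `lowerRatio` agree on the real line: both are the identity. -/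
theorem rhSolution_unique (h : IsRHSolution lam w P₁ P₂) :
    Set.EqOn P₁ (rhUpper lam w) {z | 0 ≤ z.im} ∧ Set.EqOn P₂ (rhLower lam w) {z | z.im ≤ 0} := by
  have key : ∀ a b, (∀ z : ℂ, 0 ≤ z.im → upperRatio lam w P₁ z a b =
        (1 : Matrix (Fin 4) (Fin 4) ℂ) a b) ∧
      (∀ z : ℂ, z.im ≤ 0 → (lowerRatio lam w P₂ z)⁻¹ a b =
        (1 : Matrix (Fin 4) (Fin 4) ℂ) a b) := by
    intro a b
    have hdet := fun z => lowerRatio_det_ne_zero hlam him hw h (z := z)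
    have hinv := tendsto_matrix_inv (by simp) (tendsto_lowerRatio h)
    rw [inv_one] at hinv
    refine eq_const_of_eq_on_real (f := fun z => upperRatio lam w P₁ z a b)
      (h := fun z => (lowerRatio lam w P₂ z)⁻¹ a b)
      (differentiableOn_upperRatio him h a b)
      (continuousOn_entry (continuousOn_upperRatio him h) a b)
      (tendsto_entry (tendsto_upperRatio h) a b)
      (differentiableOn_inv (differentiableOn_lowerRatio him h)
        (fun z hz => hdet z (le_of_lt hz)) a b)
      (continuousOn_entry (continuousOn_matrix_inv (continuousOn_lowerRatio him h) hdet) a b)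
      (tendsto_entry hinv a b) fun k => ?_
    rw [inv_eq_right_inv (lowerRatio_mul_upperRatio hlam him hw h k)]
  have hU : ∀ z : ℂ, 0 ≤ z.im → upperRatio lam w P₁ z = 1 := fun z hz => by
    ext a b; exact (key a b).1 z hz
  have hL : ∀ z : ℂ, z.im ≤ 0 → lowerRatio lam w P₂ z = 1 := fun z hz => by
    have h1 : (lowerRatio lam w P₂ z)⁻¹ = 1 := by ext a b; exact (key a b).2 z hz
    rw [← nonsing_inv_nonsing_inv _ (isUnit_iff_ne_zero.2
      (lowerRatio_det_ne_zero hlam him hw h hz)), h1, inv_one]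
  have hrat := isRHSolution_rational hlam him hw
  have h1 : ∀ z : ℂ, 0 ≤ z.im → (∀ k, z - lam k ≠ 0) → P₁ z = rhUpper lam w z := by
    intro z hz hz'
    rw [← Matrix.mul_one (P₁ z), ← rhLower_mul_rhUpper hlam him hw hz'
      (sub_conj_ne_zero_of_im_nonneg him hz), ← Matrix.mul_assoc, ← upperRatio_eq h hz', hU z hz,
      Matrix.one_mul]
  have h2 : ∀ z : ℂ, z.im ≤ 0 → (∀ j, z - conj (lam j) ≠ 0) → P₂ z = rhLower lam w z := by
    intro z hz hz'
    rw [← Matrix.one_mul (P₂ z), ← rhLower_mul_rhUpper hlam him hw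
      (sub_ne_zero_of_im_nonpos him hz) hz', Matrix.mul_assoc, ← lowerRatio_eq h hz', hL z hz,
      Matrix.mul_one]
  constructor
  · intro z hz
    by_cases hz' : ∀ k, z - lam k ≠ 0
    · exact h1 z hz hz'
    push Not at hz'
    obtain ⟨k, hk⟩ := hz'
    obtain rfl := sub_eq_zero.1 hk
    have hn : {z : ℂ | 0 ≤ z.im} ∈ 𝓝 (lam k) := mem_of_superset (isOpen_upper.mem_nhds (him k))
      fun z (hz : 0 < z.im) => hz.le
    refine tendsto_nhds_unique_of_eventuallyEq (l := 𝓝[≠] (lam k))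
      (((h.continuous₁).continuousAt hn).tendsto.mono_left nhdsWithin_le_nhds)
      (((hrat.continuous₁).continuousAt hn).tendsto.mono_left nhdsWithin_le_nhds) ?_
    filter_upwards [eventually_nhdsNE_sub_ne_zero lam (lam k), nhdsWithin_le_nhds hn] with y hy hy'
    exact h1 y hy' hy
  · intro z hz
    by_cases hz' : ∀ k, z - conj (lam k) ≠ 0
    · exact h2 z hz hz'
    push Not at hz'
    obtain ⟨k, hk⟩ := hz'
    obtain rfl := sub_eq_zero.1 hk
    have hn : {z : ℂ | z.im ≤ 0} ∈ 𝓝 (conj (lam k)) :=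
      mem_of_superset (isOpen_lower.mem_nhds (by simpa using him k))
        fun z (hz : z.im < 0) => hz.le
    refine tendsto_nhds_unique_of_eventuallyEq (l := 𝓝[≠] (conj (lam k)))
      (((h.continuous₂).continuousAt hn).tendsto.mono_left nhdsWithin_le_nhds)
      (((hrat.continuous₂).continuousAt hn).tendsto.mono_left nhdsWithin_le_nhds) ?_
    filter_upwards [eventually_nhdsNE_sub_ne_zero (fun j => conj (lam j)) (conj (lam k)),
      nhdsWithin_le_nhds hn] with y hy hy'
    exact h2 y hy' hy

end Unique

/-! ### Entrywise derivatives of matrix-valued functions -/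

/-- `F` has derivative `F'` at `s`, entry by entry. Rectangular matrices carry no canonical norm,
so the usual derivative is not available for them. -/
def HasEntryDerivAt {m n : Type*} (F : ℝ → Matrix m n ℂ) (F' : Matrix m n ℂ) (s : ℝ) : Prop :=
  ∀ a b, HasDerivAt (fun y => F y a b) (F' a b) s

namespace HasEntryDerivAt

variable {l m n : Type*} {F F₁ : ℝ → Matrix m n ℂ} {F' F₁' : Matrix m n ℂ} {s : ℝ}

lemma const (A : Matrix m n ℂ) (s : ℝ) : HasEntryDerivAt (fun _ => A) 0 s :=
  fun a b => hasDerivAt_const s (A a b)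

lemma add (h : HasEntryDerivAt F F' s) (h₁ : HasEntryDerivAt F₁ F₁' s) :
    HasEntryDerivAt (fun y => F y + F₁ y) (F' + F₁') s :=
  fun a b => (h a b).add (h₁ a b)

lemma sub (h : HasEntryDerivAt F F' s) (h₁ : HasEntryDerivAt F₁ F₁' s) :
    HasEntryDerivAt (fun y => F y - F₁ y) (F' - F₁') s :=
  fun a b => (h a b).sub (h₁ a b)

lemma neg (h : HasEntryDerivAt F F' s) : HasEntryDerivAt (fun y => -F y) (-F') s :=
  fun a b => (h a b).neg

lemma mul [Fintype m] {G : ℝ → Matrix l m ℂ} {G' : Matrix l m ℂ} (h₁ : HasEntryDerivAt G G' s)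
    (h : HasEntryDerivAt F F' s) :
    HasEntryDerivAt (fun y => G y * F y) (G' * F s + G s * F') s := by
  intro a b
  simp only [Matrix.mul_apply, Matrix.add_apply, ← Finset.sum_add_distrib]
  exact HasDerivAt.fun_sum fun c _ => (h₁ a c).mul (h c b)

lemma mul_const [Fintype n] (h : HasEntryDerivAt F F' s) (A : Matrix n l ℂ) :
    HasEntryDerivAt (fun y => F y * A) (F' * A) s := by
  simpa using h.mul (const A s)

lemma const_mul [Fintype m] (h : HasEntryDerivAt F F' s) (A : Matrix l m ℂ) :
    HasEntryDerivAt (fun y => A * F y) (A * F') s := by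
  simpa using (const A s).mul h

lemma congr_deriv (h : HasEntryDerivAt F F' s) (h' : F' = F₁') : HasEntryDerivAt F F₁' s :=
  h' ▸ h

lemma conjTranspose (h : HasEntryDerivAt F F' s) :
    HasEntryDerivAt (fun y => (F y)ᴴ) F'ᴴ s :=
  fun a b => (h b a).star

lemma unique (h : HasEntryDerivAt F F' s) (h₁ : HasEntryDerivAt F F₁' s) : F' = F₁' := by
  ext a b
  exact (h a b).unique (h₁ a b)

lemma inv [Fintype n] [DecidableEq n] {A : ℝ → Matrix n n ℂ} {A' : Matrix n n ℂ}
    (h : HasEntryDerivAt A A' s) (hu : ∀ y, IsUnit (A y).det) :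
    HasEntryDerivAt (fun y => (A y)⁻¹) (-((A s)⁻¹ * A' * (A s)⁻¹)) s := by
  have hA : DifferentiableAt ℝ (fun y => (fun i j => A y i j : n → n → ℂ)) s :=
    differentiableAt_pi.2 fun i => differentiableAt_pi.2 fun j => (h i j).differentiableAt
  have hd : DifferentiableAt ℝ (fun y => (A y).det) s := by
    have h1 : ContDiff ℝ 1 fun B : n → n → ℂ => (Matrix.of B).det :=
      contDiff_det fun i j => by simpa using contDiff_apply_apply ℝ ℂ i j
    exact DifferentiableAt.comp (g := fun B : n → n → ℂ => (Matrix.of B).det) s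
      (h1.differentiable one_ne_zero _) hA
  have hadj : ∀ a b, DifferentiableAt ℝ (fun y => (A y).adjugate a b) s := by
    intro a b
    have h1 : ContDiff ℝ 1 fun B : n → n → ℂ => (Matrix.of B).adjugate a b :=
      contDiff_adjugate (fun i j => by simpa using contDiff_apply_apply ℝ ℂ i j) a b
    exact DifferentiableAt.comp (g := fun B : n → n → ℂ => (Matrix.of B).adjugate a b) s
      (h1.differentiable one_ne_zero _) hA
  have hinv : ∀ a b, DifferentiableAt ℝ (fun y => (A y)⁻¹ a b) s := by
    intro a b
    simp only [Matrix.inv_def, Ring.inverse_eq_inv', Matrix.smul_apply, smul_eq_mul]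
    exact (hd.inv (hu s).ne_zero).mul (hadj a b)
  set K' : Matrix n n ℂ := Matrix.of fun a b => deriv (fun y => (A y)⁻¹ a b) s
  have hK : HasEntryDerivAt (fun y => (A y)⁻¹) K' s := fun a b => (hinv a b).hasDerivAt
  have h1 := hK.mul h
  have h2 : (fun y => (A y)⁻¹ * A y) = fun _ => 1 := funext fun y => nonsing_inv_mul _ (hu y)
  rw [h2] at h1
  have h3 := h1.unique (const 1 s)
  refine hK.congr_deriv ?_
  rw [← Matrix.mul_one K', ← mul_nonsing_inv _ (hu s), ← Matrix.mul_assoc,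
    eq_neg_of_add_eq_zero_left h3, Matrix.neg_mul]

end HasEntryDerivAt

/-! ### Evolution of the dressing matrices -/

/-- The coefficient of `z ^ (-n - 1)` in the expansion of `rhUpper` at infinity. -/
noncomputable def upperMoment {N : ℕ} (lam : Fin N → ℂ) (w : Fin N → Fin 4 → ℂ) (n : ℕ) :
    Matrix (Fin 4) (Fin 4) ℂ :=
  -(frame w * ((gramMatrix lam w)⁻¹ * diagonal (fun j => conj (lam j)) ^ n) * (frame w)ᴴ)

/-- The coefficient of `z ^ (-n - 1)` in the expansion of `rhLower` at infinity. -/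
noncomputable def lowerMoment {N : ℕ} (lam : Fin N → ℂ) (w : Fin N → Fin 4 → ℂ) (n : ℕ) :
    Matrix (Fin 4) (Fin 4) ℂ :=
  frame w * (diagonal lam ^ n * (gramMatrix lam w)⁻¹) * (frame w)ᴴ

section Algebra

variable {N : ℕ} {lam : Fin N → ℂ} {w : Fin N → Fin 4 → ℂ}

lemma lowerMoment_zero : lowerMoment lam w 0 = -upperMoment lam w 0 := by
  simp [lowerMoment, upperMoment]

/-- The Lyapunov equation, multiplied by the inverse of the Gram matrix on both sides. -/
lemma gramInv_commutator (hlam : Function.Injective lam) (him : ∀ j, 0 < (lam j).im)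
    (hw : ∀ j, w j ≠ 0) :
    diagonal lam * (gramMatrix lam w)⁻¹ = (gramMatrix lam w)⁻¹ * diagonal (fun j => conj (lam j))
      + (gramMatrix lam w)⁻¹ * (frame w)ᴴ * frame w * (gramMatrix lam w)⁻¹ := by
  have hu := gramMatrix_det_isUnit hlam him hw
  set K := (gramMatrix lam w)⁻¹
  have h1 : K * gramMatrix lam w = 1 := nonsing_inv_mul _ hu
  have h2 : gramMatrix lam w * K = 1 := mul_nonsing_inv _ hu
  rw [Matrix.mul_assoc K, ← gramMatrix_lyapunov him]
  calc diagonal lam * K = (K * gramMatrix lam w) * diagonal lam * K := by rw [h1, Matrix.one_mul]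
    _ = K * diagonal (fun j => conj (lam j)) * (1 - gramMatrix lam w * K)
        + (K * gramMatrix lam w) * diagonal lam * K := by rw [h2]; simp
    _ = _ := by noncomm_ring

variable (hlam : Function.Injective lam) (him : ∀ j, 0 < (lam j).im) (hw : ∀ j, w j ≠ 0)
include hlam him hw

lemma frame_lam_gramInv (n : ℕ) :
    frame w * (diagonal lam * ((gramMatrix lam w)⁻¹ * diagonal (fun j => conj (lam j)) ^ n))
        * (frame w)ᴴ
      = upperMoment lam w 0 * upperMoment lam w n - upperMoment lam w (n + 1) := by
  rw [← Matrix.mul_assoc (diagonal lam), gramInv_commutator hlam him hw]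
  simp only [upperMoment, pow_succ', pow_zero, Matrix.mul_one, Matrix.add_mul, Matrix.mul_add,
    Matrix.mul_assoc, Matrix.neg_mul, Matrix.mul_neg, neg_neg, sub_neg_eq_add]
  abel

lemma frame_gramInv_conj (n : ℕ) :
    frame w * (diagonal lam ^ n * ((gramMatrix lam w)⁻¹ * diagonal (fun j => conj (lam j))))
        * (frame w)ᴴ
      = lowerMoment lam w (n + 1) + lowerMoment lam w n * upperMoment lam w 0 := by
  rw [← sub_eq_iff_eq_add.2 (gramInv_commutator hlam him hw)]
  simp only [lowerMoment, upperMoment, pow_succ, pow_zero, Matrix.mul_one, Matrix.sub_mul,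
    Matrix.mul_sub, Matrix.mul_assoc, Matrix.mul_neg]
  abel

lemma lowerMoment_succ (n m : ℕ) :
    frame w * (diagonal lam ^ (n + 1) * ((gramMatrix lam w)⁻¹ *
        diagonal (fun j => conj (lam j)) ^ m)) * (frame w)ᴴ
      = frame w * (diagonal lam ^ n * ((gramMatrix lam w)⁻¹ *
        diagonal (fun j => conj (lam j)) ^ (m + 1))) * (frame w)ᴴ
        - lowerMoment lam w n * upperMoment lam w m := by
  rw [pow_succ, Matrix.mul_assoc (diagonal lam ^ n), ← Matrix.mul_assoc (diagonal lam),
    gramInv_commutator hlam him hw]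
  simp only [lowerMoment, upperMoment, pow_succ', Matrix.add_mul, Matrix.mul_add,
    Matrix.mul_assoc, Matrix.mul_neg, sub_neg_eq_add]

lemma lowerMoment_one : lowerMoment lam w 1
    = -upperMoment lam w 1 - lowerMoment lam w 0 * upperMoment lam w 0 := by
  have h := lowerMoment_succ hlam him hw 0 0
  simpa [lowerMoment, upperMoment] using h

lemma lowerMoment_two : lowerMoment lam w 2 = -upperMoment lam w 2
    - lowerMoment lam w 1 * upperMoment lam w 0 - lowerMoment lam w 0 * upperMoment lam w 1 := by
  have h := lowerMoment_succ hlam him hw 1 0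
  rw [lowerMoment_succ hlam him hw 0 1] at h
  rw [sub_sub, add_comm, ← sub_sub, upperMoment, neg_neg]
  simpa [lowerMoment] using h

end Algebra

section Flow

variable {N : ℕ} {lam : Fin N → ℂ} {w : ℝ → Fin N → Fin 4 → ℂ} {p : Fin N → ℂ} {s : ℝ}

lemma hasEntryDerivAt_frame
    (h : ∀ j a, HasDerivAt (fun y => w y j a) (Complex.I * p j * sig a * w s j a) s) :
    HasEntryDerivAt (fun y => frame (w y))
      (Complex.I • (diagonal sig * frame (w s) * diagonal p)) s := by
  intro a j
  refine (h j a).congr_deriv ?_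
  rw [Matrix.smul_apply, mul_diagonal, diagonal_mul]
  simp only [frame, of_apply, smul_eq_mul]
  ring

lemma sig_conj (a : Fin 4) : conj (sig a) = sig a := by
  fin_cases a <;> simp [sig, Complex.conj_ofNat]

lemma diagonal_sig_conjTranspose : (diagonal sig)ᴴ = diagonal sig := by
  rw [diagonal_conjTranspose]
  exact congrArg _ (funext sig_conj)

lemma hasEntryDerivAt_frame_conjTranspose
    (h : ∀ j a, HasDerivAt (fun y => w y j a) (Complex.I * p j * sig a * w s j a) s) :
    HasEntryDerivAt (fun y => (frame (w y))ᴴ)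
      (-(Complex.I • (diagonal (fun j => conj (p j)) * (frame (w s))ᴴ * diagonal sig))) s := by
  refine (hasEntryDerivAt_frame h).conjTranspose.congr_deriv ?_
  rw [conjTranspose_smul, conjTranspose_mul, conjTranspose_mul, diagonal_sig_conjTranspose,
    diagonal_conjTranspose, Matrix.mul_assoc]
  simp only [RCLike.star_def, Complex.conj_I, neg_smul]
  rfl

/-- When the norming vectors evolve by `w_j' = i p_j σ w_j`, the denominators `λ_j - λ_k^*` of the
Gram matrix turn into the divided differences of `p`. -/
lemma hasEntryDerivAt_gramMatrix {E : Matrix (Fin N) (Fin N) ℂ} (him : ∀ j, 0 < (lam j).im)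
    (h : ∀ j a, HasDerivAt (fun y => w y j a) (Complex.I * p j * sig a * w s j a) s)
    (hE : ∀ k j, E k j * (lam j - conj (lam k))
      = (p j - conj (p k)) * ((frame (w s))ᴴ * diagonal sig * frame (w s)) k j) :
    HasEntryDerivAt (fun y => gramMatrix lam (w y)) (Complex.I • E) s := by
  intro k j
  have h1 := ((hasEntryDerivAt_frame_conjTranspose h).mul (hasEntryDerivAt_frame h) k j).div_const
    (lam j - conj (lam k))
  refine h1.congr_deriv ?_
  rw [div_eq_iff (sub_conj_ne_zero (him k) (him j)), Matrix.smul_apply, smul_mul_assoc, hE k j]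
  have e1 : -(Complex.I • (diagonal (fun j => conj (p j)) * (frame (w s))ᴴ * diagonal sig))
      * frame (w s) = -(Complex.I • (diagonal (fun j => conj (p j)) *
        ((frame (w s))ᴴ * diagonal sig * frame (w s)))) := by
    simp only [Matrix.neg_mul, Matrix.smul_mul, Matrix.mul_assoc]
  have e2 : (frame (w s))ᴴ * (Complex.I • (diagonal sig * frame (w s) * diagonal p))
      = Complex.I • ((frame (w s))ᴴ * diagonal sig * frame (w s) * diagonal p) := by
    simp only [Matrix.mul_smul, Matrix.mul_assoc]
  rw [e1, e2]
  simp only [Matrix.add_apply, Matrix.neg_apply, Matrix.smul_apply, diagonal_mul, mul_diagonal,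
    smul_eq_mul]
  ring

end Flow

section FlowMoments

variable {N : ℕ} {lam : Fin N → ℂ} {w : ℝ → Fin N → Fin 4 → ℂ} {s : ℝ}

/-- The `x`-derivative of the Gram matrix is `i c Wᴴ σ W`. -/
lemma hasEntryDerivAt_gramMatrix_linear {c : ℂ} (hc : conj c = c) (him : ∀ j, 0 < (lam j).im)
    (h : ∀ j a, HasDerivAt (fun y => w y j a) (Complex.I * (c * lam j) * sig a * w s j a) s) :
    HasEntryDerivAt (fun y => gramMatrix lam (w y))
      (Complex.I • c • ((frame (w s))ᴴ * diagonal sig * frame (w s))) s := by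
  refine hasEntryDerivAt_gramMatrix him h fun k j => ?_
  rw [map_mul, hc, Matrix.smul_apply, smul_eq_mul]
  ring

lemma hasEntryDerivAt_gramMatrix_cubic {c d : ℂ} (hc : conj c = c) (hd : conj d = d)
    (him : ∀ j, 0 < (lam j).im)
    (h : ∀ j a, HasDerivAt (fun y => w y j a)
      (Complex.I * (c * lam j ^ 3 + d * lam j ^ 2) * sig a * w s j a) s) :
    HasEntryDerivAt (fun y => gramMatrix lam (w y))
      (Complex.I • (c • ((frame (w s))ᴴ * diagonal sig * frame (w s) * diagonal lam ^ 2
          + diagonal (fun j => conj (lam j)) * ((frame (w s))ᴴ * diagonal sig * frame (w s))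
            * diagonal lam
          + diagonal (fun j => conj (lam j)) ^ 2 * ((frame (w s))ᴴ * diagonal sig * frame (w s)))
        + d • ((frame (w s))ᴴ * diagonal sig * frame (w s) * diagonal lam
          + diagonal (fun j => conj (lam j)) *
            ((frame (w s))ᴴ * diagonal sig * frame (w s))))) s := by
  refine hasEntryDerivAt_gramMatrix him h fun k j => ?_
  simp only [map_mul, map_add, map_pow, hc, hd, Matrix.smul_apply, smul_eq_mul, Matrix.add_apply,
    diagonal_pow, diagonal_mul, mul_diagonal, Pi.pow_apply]
  ring

lemma diagonal_const_mul (c : ℂ) (v : Fin N → ℂ) :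
    diagonal (fun j => c * v j) = c • diagonal v := by
  rw [← diagonal_smul]; rfl

variable (hlam : Function.Injective lam) (him : ∀ j, 0 < (lam j).im) (hw : ∀ y j, w y j ≠ 0)
include hlam him hw

lemma hasEntryDerivAt_gramInv {G' : Matrix (Fin N) (Fin N) ℂ}
    (h : HasEntryDerivAt (fun y => gramMatrix lam (w y)) G' s) :
    HasEntryDerivAt (fun y => (gramMatrix lam (w y))⁻¹)
      (-((gramMatrix lam (w s))⁻¹ * G' * (gramMatrix lam (w s))⁻¹)) s :=
  h.inv fun y => gramMatrix_det_isUnit hlam him (hw y)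

lemma hasEntryDerivAt_upperMoment {c : ℂ} (hc : conj c = c)
    (h : ∀ j a, HasDerivAt (fun y => w y j a) (Complex.I * (c * lam j) * sig a * w s j a) s)
    (n : ℕ) :
    HasEntryDerivAt (fun y => upperMoment lam (w y) n)
      ((Complex.I * c) • (diagonal sig * upperMoment lam (w s) (n + 1)
        - upperMoment lam (w s) (n + 1) * diagonal sig
        - (diagonal sig * upperMoment lam (w s) 0 - upperMoment lam (w s) 0 * diagonal sig)
          * upperMoment lam (w s) n)) s := by
  have hG := hasEntryDerivAt_gramInv hlam him hw (hasEntryDerivAt_gramMatrix_linear hc him h)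
  have h1 := (((hasEntryDerivAt_frame h).mul
    (hG.mul_const (diagonal (fun j => conj (lam j)) ^ n))).mul
    (hasEntryDerivAt_frame_conjTranspose h)).neg
  refine h1.congr_deriv ?_
  have e : diagonal sig * upperMoment lam (w s) (n + 1)
        - upperMoment lam (w s) (n + 1) * diagonal sig
        - (diagonal sig * upperMoment lam (w s) 0 - upperMoment lam (w s) 0 * diagonal sig)
          * upperMoment lam (w s) n
      = -(diagonal sig * (frame (w s) * (diagonal lam * ((gramMatrix lam (w s))⁻¹ *
          diagonal (fun j => conj (lam j)) ^ n)) * (frame (w s))ᴴ))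
        + upperMoment lam (w s) 0 * diagonal sig * upperMoment lam (w s) n
        - upperMoment lam (w s) (n + 1) * diagonal sig := by
    rw [frame_lam_gramInv hlam him (hw s)]
    noncomm_ring
  rw [e]
  simp only [map_mul, hc, diagonal_const_mul, upperMoment, pow_succ, pow_zero, Matrix.mul_one,
    Matrix.mul_smul, Matrix.smul_mul, Matrix.add_mul, Matrix.mul_neg, Matrix.neg_mul, neg_neg,
    Matrix.mul_assoc]
  module

lemma hasEntryDerivAt_lowerMoment {c : ℂ} (hc : conj c = c)
    (h : ∀ j a, HasDerivAt (fun y => w y j a) (Complex.I * (c * lam j) * sig a * w s j a) s)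
    (n : ℕ) :
    HasEntryDerivAt (fun y => lowerMoment lam (w y) n)
      ((Complex.I * c) • (diagonal sig * lowerMoment lam (w s) (n + 1)
        - lowerMoment lam (w s) (n + 1) * diagonal sig
        + lowerMoment lam (w s) n *
          (diagonal sig * upperMoment lam (w s) 0 - upperMoment lam (w s) 0 * diagonal sig)))
      s := by
  have hG := hasEntryDerivAt_gramInv hlam him hw (hasEntryDerivAt_gramMatrix_linear hc him h)
  have h1 := (((hasEntryDerivAt_frame h).mul
    (hG.const_mul (diagonal lam ^ n))).mul
    (hasEntryDerivAt_frame_conjTranspose h))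
  refine h1.congr_deriv ?_
  have e : diagonal sig * lowerMoment lam (w s) (n + 1)
        - lowerMoment lam (w s) (n + 1) * diagonal sig
        + lowerMoment lam (w s) n *
          (diagonal sig * upperMoment lam (w s) 0 - upperMoment lam (w s) 0 * diagonal sig)
      = diagonal sig * lowerMoment lam (w s) (n + 1)
        + lowerMoment lam (w s) n * diagonal sig * upperMoment lam (w s) 0
        - frame (w s) * (diagonal lam ^ n * ((gramMatrix lam (w s))⁻¹ *
          diagonal (fun j => conj (lam j)))) * (frame (w s))ᴴ * diagonal sig := by
    rw [frame_gramInv_conj hlam him (hw s)]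
    noncomm_ring
  rw [e]
  simp only [map_mul, hc, diagonal_const_mul, lowerMoment, upperMoment, pow_succ', pow_zero,
    Matrix.mul_one, Matrix.mul_smul, Matrix.smul_mul, Matrix.add_mul, Matrix.mul_neg,
    Matrix.neg_mul, Matrix.mul_assoc]
  module

/-- The `t`-flow of the first moment, in terms of the expansion of `rhUpper σ rhLower`. -/
lemma hasEntryDerivAt_upperMoment_cubic {c d : ℂ} (hc : conj c = c) (hd : conj d = d)
    (h : ∀ j a, HasDerivAt (fun y => w y j a)
      (Complex.I * (c * lam j ^ 3 + d * lam j ^ 2) * sig a * w s j a) s) :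
    HasEntryDerivAt (fun y => upperMoment lam (w y) 0)
      (-(Complex.I • (c • (upperMoment lam (w s) 3 * diagonal sig
            + diagonal sig * lowerMoment lam (w s) 3
            + upperMoment lam (w s) 2 * diagonal sig * lowerMoment lam (w s) 0
            + upperMoment lam (w s) 1 * diagonal sig * lowerMoment lam (w s) 1
            + upperMoment lam (w s) 0 * diagonal sig * lowerMoment lam (w s) 2)
          + d • (upperMoment lam (w s) 2 * diagonal sig
            + diagonal sig * lowerMoment lam (w s) 2
            + upperMoment lam (w s) 1 * diagonal sig * lowerMoment lam (w s) 0
            + upperMoment lam (w s) 0 * diagonal sig * lowerMoment lam (w s) 1)))) s := by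
  have hG := hasEntryDerivAt_gramInv hlam him hw (hasEntryDerivAt_gramMatrix_cubic hc hd him h)
  have h1 := (((hasEntryDerivAt_frame h).mul
    (hG.mul_const (diagonal (fun j => conj (lam j)) ^ 0))).mul
    (hasEntryDerivAt_frame_conjTranspose h)).neg
  refine h1.congr_deriv ?_
  have e1 : diagonal (fun j => c * lam j ^ 3 + d * lam j ^ 2)
      = c • diagonal lam ^ 3 + d • diagonal lam ^ 2 := by
    rw [diagonal_pow, diagonal_pow, ← diagonal_smul, ← diagonal_smul, diagonal_add]; rfl
  have e2 : diagonal (fun j => conj (c * lam j ^ 3 + d * lam j ^ 2))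
      = c • diagonal (fun j => conj (lam j)) ^ 3 + d • diagonal (fun j => conj (lam j)) ^ 2 := by
    rw [diagonal_pow, diagonal_pow, ← diagonal_smul, ← diagonal_smul, diagonal_add]
    simp only [map_add, map_mul, map_pow, hc, hd]; rfl
  rw [e1, e2]
  simp only [lowerMoment, upperMoment, pow_succ, pow_zero, Matrix.mul_one, smul_add,
    Matrix.mul_smul, Matrix.smul_mul, Matrix.add_mul, Matrix.mul_add, Matrix.mul_neg,
    Matrix.neg_mul, Matrix.mul_assoc, Matrix.one_mul]
  module

/-- The rational solution of the Riemann-Hilbert problem satisfies the spectral problem. -/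
lemma hasEntryDerivAt_rhUpper {c : ℂ} (hc : conj c = c)
    (h : ∀ j a, HasDerivAt (fun y => w y j a) (Complex.I * (c * lam j) * sig a * w s j a) s)
    {z : ℂ} (hz : ∀ j, z - conj (lam j) ≠ 0) :
    HasEntryDerivAt (fun y => rhUpper lam (w y) z)
      ((Complex.I * z * c) • (diagonal sig * rhUpper lam (w s) z
          - rhUpper lam (w s) z * diagonal sig)
        + ((Complex.I * c) • (upperMoment lam (w s) 0 * diagonal sig
            - diagonal sig * upperMoment lam (w s) 0)) * rhUpper lam (w s) z) s := by
  have hG := hasEntryDerivAt_gramInv hlam him hw (hasEntryDerivAt_gramMatrix_linear hc him h)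
  set D := diagonal (fun j => (z - conj (lam j))⁻¹) with hD
  have h1 := ((HasEntryDerivAt.const 1 s).sub ((((hasEntryDerivAt_frame h).mul hG).mul_const D).mul
    (hasEntryDerivAt_frame_conjTranspose h)))
  have h2 : (fun y => rhUpper lam (w y) z) = fun y => 1 - frame (w y) * (gramMatrix lam (w y))⁻¹ *
    D * (frame (w y))ᴴ := funext fun y => rhUpper_eq z
  rw [h2]
  refine h1.congr_deriv ?_
  rw [rhUpper_eq, ← hD]
  set W := frame (w s)
  set V := Wᴴ
  set K := (gramMatrix lam (w s))⁻¹
  set C := diagonal (fun j => conj (lam j)) with hC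
  have hDC : D * C = z • D - 1 := by
    rw [hD, hC, diagonal_mul_diagonal, ← diagonal_smul, ← diagonal_one, diagonal_sub]
    refine congrArg _ (funext fun j => ?_)
    have := hz j
    simp only [Pi.smul_apply, smul_eq_mul]
    field_simp
    ring
  have hCD : C * D = z • D - 1 := by
    rw [← hDC, hD, hC, diagonal_mul_diagonal, diagonal_mul_diagonal]
    exact congrArg _ (funext fun j => mul_comm _ _)
  have e1 : diagonal lam * K * D = z • (K * D) - K + K * V * W * K * D := by
    rw [gramInv_commutator hlam him (hw s), Matrix.add_mul, Matrix.mul_assoc K, hCD]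
    simp [Matrix.mul_sub, Matrix.mul_assoc, W, V, K]
  have e2 : (Complex.I • (diagonal sig * W * diagonal fun j => c * lam j)) * K * D * V
      = (Complex.I * c) • (diagonal sig * W * (z • (K * D) - K + K * V * W * K * D) * V) := by
    rw [← e1, diagonal_const_mul]
    simp only [Matrix.smul_mul, Matrix.mul_smul, Matrix.mul_assoc, smul_smul]
  have e3 : W * K * D * -(Complex.I • (diagonal (fun j => conj (c * lam j)) * V * diagonal sig))
      = -((Complex.I * c) • (W * K * (z • D - 1) * V * diagonal sig)) := by
    rw [← hDC]
    simp only [map_mul, hc, diagonal_const_mul]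
    simp only [Matrix.smul_mul, Matrix.mul_smul, Matrix.mul_assoc, smul_smul, Matrix.mul_neg, hC]
  rw [Matrix.add_mul, Matrix.add_mul, e2, e3]
  simp only [upperMoment, pow_zero, Matrix.mul_one, Matrix.mul_sub, Matrix.sub_mul, Matrix.one_mul,
    Matrix.mul_smul, Matrix.smul_mul, Matrix.add_mul, Matrix.mul_add, Matrix.mul_neg,
    Matrix.neg_mul, Matrix.mul_assoc, W, V, K]
  module

end FlowMoments

/-! ### The hierarchy for `rhUpper σ rhLower` -/

/-- The coefficient of `z ^ (-n - 1)` in the expansion of `rhUpper σ rhLower` at infinity. -/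
noncomputable def dressedSig {N : ℕ} (lam : Fin N → ℂ) (w : Fin N → Fin 4 → ℂ) (n : ℕ) :
    Matrix (Fin 4) (Fin 4) ℂ :=
  upperMoment lam w n * diagonal sig + diagonal sig * lowerMoment lam w n
    + ∑ a ∈ Finset.range n, upperMoment lam w a * diagonal sig * lowerMoment lam w (n - 1 - a)

lemma diagonal_sig_mul_self : diagonal sig * diagonal sig = 2 - diagonal sig := by
  ext a b
  fin_cases a <;> fin_cases b <;> simp [sig, Matrix.ofNat_apply] <;> norm_num

lemma diagonal_sig_mul_self_assoc (A : Matrix (Fin 4) (Fin 4) ℂ) :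
    diagonal sig * (diagonal sig * A) = 2 * A - diagonal sig * A := by
  rw [← Matrix.mul_assoc, diagonal_sig_mul_self, Matrix.sub_mul]

section Quadratic

variable {N : ℕ} {lam : Fin N → ℂ} {w : Fin N → Fin 4 → ℂ}

lemma dressedSig_zero : dressedSig lam w 0
    = upperMoment lam w 0 * diagonal sig - diagonal sig * upperMoment lam w 0 := by
  simp [dressedSig, lowerMoment_zero, sub_eq_add_neg]

lemma dressedSig_one : dressedSig lam w 1
    = upperMoment lam w 1 * diagonal sig + diagonal sig * lowerMoment lam w 1
      - upperMoment lam w 0 * diagonal sig * upperMoment lam w 0 := by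
  simp [dressedSig, lowerMoment_zero, sub_eq_add_neg]

lemma dressedSig_two : dressedSig lam w 2
    = upperMoment lam w 2 * diagonal sig + diagonal sig * lowerMoment lam w 2
      + (upperMoment lam w 0 * diagonal sig * lowerMoment lam w 1
        - upperMoment lam w 1 * diagonal sig * upperMoment lam w 0) := by
  simp [dressedSig, Finset.sum_range_succ, lowerMoment_zero, sub_eq_add_neg]

lemma dressedSig_three : dressedSig lam w 3
    = upperMoment lam w 3 * diagonal sig + diagonal sig * lowerMoment lam w 3
      + (upperMoment lam w 0 * diagonal sig * lowerMoment lam w 2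
        + upperMoment lam w 1 * diagonal sig * lowerMoment lam w 1
        - upperMoment lam w 2 * diagonal sig * upperMoment lam w 0) := by
  simp [dressedSig, Finset.sum_range_succ, lowerMoment_zero, sub_eq_add_neg]

variable (hlam : Function.Injective lam) (him : ∀ j, 0 < (lam j).im) (hw : ∀ j, w j ≠ 0)
include hlam him hw

/-- The `z ^ (-2)` term of the relation `S ^ 2 + S = 2` for `S = rhUpper σ rhLower`, which is
similar to `σ`. -/
lemma dressedSig_quadratic_one :
    diagonal sig * dressedSig lam w 1 + dressedSig lam w 1 * diagonal sig + dressedSig lam w 1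
      + dressedSig lam w 0 * dressedSig lam w 0 = 0 := by
  rw [dressedSig_one, dressedSig_zero, lowerMoment_one hlam him hw, lowerMoment_zero]
  simp only [Matrix.mul_add, Matrix.add_mul, Matrix.mul_sub, Matrix.sub_mul, Matrix.mul_assoc,
    diagonal_sig_mul_self, diagonal_sig_mul_self_assoc, Matrix.neg_mul, Matrix.mul_neg]
  noncomm_ring

/-- The `z ^ (-3)` term of the relation `S ^ 2 + S = 2`. -/
lemma dressedSig_quadratic_two :
    diagonal sig * dressedSig lam w 2 + dressedSig lam w 2 * diagonal sig + dressedSig lam w 2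
      + dressedSig lam w 0 * dressedSig lam w 1 + dressedSig lam w 1 * dressedSig lam w 0 = 0 := by
  rw [dressedSig_two, dressedSig_one, dressedSig_zero, lowerMoment_two hlam him hw,
    lowerMoment_one hlam him hw, lowerMoment_zero]
  simp only [Matrix.mul_add, Matrix.add_mul, Matrix.mul_sub, Matrix.sub_mul, Matrix.mul_assoc,
    diagonal_sig_mul_self, diagonal_sig_mul_self_assoc, Matrix.neg_mul, Matrix.mul_neg]
  noncomm_ring

end Quadratic

section Hierarchy

lemma commutator_identity_one {R : Type*} [Ring R] (σ X₀ X₁ X₂ Z₁ Z₂ : R)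
    (h : X₁ = X₀ * X₀ - Z₁) :
    (σ * X₂ - X₂ * σ - (σ * X₀ - X₀ * σ) * X₁) * σ
        + σ * (σ * Z₂ - Z₂ * σ + Z₁ * (σ * X₀ - X₀ * σ))
        - ((σ * X₁ - X₁ * σ - (σ * X₀ - X₀ * σ) * X₀) * σ * X₀
          + X₀ * σ * (σ * X₁ - X₁ * σ - (σ * X₀ - X₀ * σ) * X₀))
      = σ * (X₂ * σ + σ * Z₂ + (X₀ * σ * Z₁ - X₁ * σ * X₀))
        - (X₂ * σ + σ * Z₂ + (X₀ * σ * Z₁ - X₁ * σ * X₀)) * σ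
        + ((X₀ * σ - σ * X₀) * (X₁ * σ + σ * Z₁ - X₀ * σ * X₀)
          - (X₁ * σ + σ * Z₁ - X₀ * σ * X₀) * (X₀ * σ - σ * X₀)) := by
  subst h
  noncomm_ring

lemma commutator_identity_two {R : Type*} [Ring R] (σ X₀ X₁ X₂ X₃ Z₁ Z₂ Z₃ : R)
    (h : X₁ = X₀ * X₀ - Z₁) :
    (σ * X₃ - X₃ * σ - (σ * X₀ - X₀ * σ) * X₂) * σ
        + σ * (σ * Z₃ - Z₃ * σ + Z₂ * (σ * X₀ - X₀ * σ))
        + ((σ * X₁ - X₁ * σ - (σ * X₀ - X₀ * σ) * X₀) * σ * Z₁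
          + X₀ * σ * (σ * Z₂ - Z₂ * σ + Z₁ * (σ * X₀ - X₀ * σ))
          - ((σ * X₂ - X₂ * σ - (σ * X₀ - X₀ * σ) * X₁) * σ * X₀
            + X₁ * σ * (σ * X₁ - X₁ * σ - (σ * X₀ - X₀ * σ) * X₀)))
      = σ * (X₃ * σ + σ * Z₃ + (X₀ * σ * Z₂ + X₁ * σ * Z₁ - X₂ * σ * X₀))
        - (X₃ * σ + σ * Z₃ + (X₀ * σ * Z₂ + X₁ * σ * Z₁ - X₂ * σ * X₀)) * σ
        + ((X₀ * σ - σ * X₀) * (X₂ * σ + σ * Z₂ + (X₀ * σ * Z₁ - X₁ * σ * X₀))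
          - (X₂ * σ + σ * Z₂ + (X₀ * σ * Z₁ - X₁ * σ * X₀)) * (X₀ * σ - σ * X₀)) := by
  subst h
  simp only [mul_add, add_mul, mul_sub, sub_mul, mul_assoc]
  abel

variable {N : ℕ} {lam : Fin N → ℂ} {w : ℝ → Fin N → Fin 4 → ℂ} {s : ℝ}
variable (hlam : Function.Injective lam) (him : ∀ j, 0 < (lam j).im) (hw : ∀ y j, w y j ≠ 0)
include hlam him hw

lemma hasEntryDerivAt_dressedSig_zero {c : ℂ} (hc : conj c = c)
    (h : ∀ j a, HasDerivAt (fun y => w y j a) (Complex.I * (c * lam j) * sig a * w s j a) s) :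
    HasEntryDerivAt (fun y => dressedSig lam (w y) 0)
      ((Complex.I * c) • (diagonal sig * dressedSig lam (w s) 1
        - dressedSig lam (w s) 1 * diagonal sig)) s := by
  have hX := hasEntryDerivAt_upperMoment hlam him hw hc h
  simp only [dressedSig_zero, dressedSig_one]
  refine (((hX 0).mul_const (diagonal sig)).sub ((hX 0).const_mul (diagonal sig))).congr_deriv ?_
  rw [lowerMoment_one hlam him (hw s), lowerMoment_zero, Matrix.smul_mul, Matrix.mul_smul,
    ← smul_sub]
  congr 1
  noncomm_ring

/-- The `z ^ (-2)` term of `S' = [i c z σ + Q, S]` for `S = rhUpper σ rhLower`. -/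
lemma hasEntryDerivAt_dressedSig_one {c : ℂ} (hc : conj c = c)
    (h : ∀ j a, HasDerivAt (fun y => w y j a) (Complex.I * (c * lam j) * sig a * w s j a) s) :
    HasEntryDerivAt (fun y => dressedSig lam (w y) 1)
      ((Complex.I * c) • (diagonal sig * dressedSig lam (w s) 2
        - dressedSig lam (w s) 2 * diagonal sig
        + (dressedSig lam (w s) 0 * dressedSig lam (w s) 1
          - dressedSig lam (w s) 1 * dressedSig lam (w s) 0))) s := by
  have hX0 := hasEntryDerivAt_upperMoment hlam him hw hc h 0
  have hX1 := hasEntryDerivAt_upperMoment hlam him hw hc h 1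
  have hZ1 := hasEntryDerivAt_lowerMoment hlam him hw hc h 1
  simp only [zero_add, Nat.reduceAdd] at *
  simp only [dressedSig_zero, dressedSig_one, dressedSig_two]
  refine (((hX1.mul_const (diagonal sig)).add (hZ1.const_mul (diagonal sig))).sub
    ((hX0.mul_const (diagonal sig)).mul hX0)).congr_deriv ?_
  simp only [Matrix.smul_mul, Matrix.mul_smul, ← smul_sub, ← smul_add]
  congr 1
  exact commutator_identity_one _ _ _ _ _ _ (by
    rw [lowerMoment_one hlam him (hw s), lowerMoment_zero]; noncomm_ring)

/-- The `z ^ (-3)` term of `S' = [i c z σ + Q, S]`. -/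
lemma hasEntryDerivAt_dressedSig_two {c : ℂ} (hc : conj c = c)
    (h : ∀ j a, HasDerivAt (fun y => w y j a) (Complex.I * (c * lam j) * sig a * w s j a) s) :
    HasEntryDerivAt (fun y => dressedSig lam (w y) 2)
      ((Complex.I * c) • (diagonal sig * dressedSig lam (w s) 3
        - dressedSig lam (w s) 3 * diagonal sig
        + (dressedSig lam (w s) 0 * dressedSig lam (w s) 2
          - dressedSig lam (w s) 2 * dressedSig lam (w s) 0))) s := by
  have hX0 := hasEntryDerivAt_upperMoment hlam him hw hc h 0
  have hX1 := hasEntryDerivAt_upperMoment hlam him hw hc h 1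
  have hX2 := hasEntryDerivAt_upperMoment hlam him hw hc h 2
  have hZ1 := hasEntryDerivAt_lowerMoment hlam him hw hc h 1
  have hZ2 := hasEntryDerivAt_lowerMoment hlam him hw hc h 2
  simp only [zero_add, Nat.reduceAdd] at *
  simp only [dressedSig_zero, dressedSig_two, dressedSig_three]
  refine (((hX2.mul_const (diagonal sig)).add (hZ2.const_mul (diagonal sig))).add
    (((hX0.mul_const (diagonal sig)).mul hZ1).sub
      ((hX1.mul_const (diagonal sig)).mul hX0))).congr_deriv ?_
  simp only [Matrix.smul_mul, Matrix.mul_smul, ← smul_sub, ← smul_add]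
  congr 1
  exact commutator_identity_two _ _ _ _ _ _ _ _ (by
    rw [lowerMoment_one hlam him (hw s), lowerMoment_zero]; noncomm_ring)

lemma hasEntryDerivAt_dressedSig_cubic {c d : ℂ} (hc : conj c = c) (hd : conj d = d)
    (h : ∀ j a, HasDerivAt (fun y => w y j a)
      (Complex.I * (c * lam j ^ 3 + d * lam j ^ 2) * sig a * w s j a) s) :
    HasEntryDerivAt (fun y => dressedSig lam (w y) 0)
      (Complex.I • (diagonal sig * (c • dressedSig lam (w s) 3 + d • dressedSig lam (w s) 2)
        - (c • dressedSig lam (w s) 3 + d • dressedSig lam (w s) 2) * diagonal sig)) s := by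
  have hX := hasEntryDerivAt_upperMoment_cubic hlam him hw hc hd h
  simp only [dressedSig_zero]
  refine ((hX.mul_const (diagonal sig)).sub (hX.const_mul (diagonal sig))).congr_deriv ?_
  rw [dressedSig_three, dressedSig_two, lowerMoment_zero]
  simp only [Matrix.smul_mul, Matrix.mul_smul, Matrix.mul_add, Matrix.add_mul, Matrix.mul_sub,
    Matrix.sub_mul, Matrix.neg_mul, Matrix.mul_neg, Matrix.mul_assoc]
  module

end Hierarchy

/-! ### Norming vectors and the reconstructed potential -/

section Concrete

variable {ε : ℝ}

lemma conj_c₁ (ε : ℝ) : conj (c₁ ε) = c₁ ε := by simp [c₁, Complex.conj_ofNat]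

lemma conj_c₂ (ε : ℝ) : conj (c₂ ε) = c₂ ε := by simp [c₂, Complex.conj_ofNat]

lemma conj_c₃ (ε : ℝ) : conj (c₃ ε) = c₃ ε := by simp [c₃, Complex.conj_ofNat]

lemma normVec_apply (ε : ℝ) (z a b g : ℂ) (x t : ℝ) (i : Fin 4) :
    normVec ε z a b g x t i = ![a, b, g, 1] i * Complex.exp (sig i * phase ε z x t) := by
  fin_cases i <;> simp [normVec, sig]

lemma hasDerivAt_phase_x (ε : ℝ) (z : ℂ) (x t : ℝ) :
    HasDerivAt (fun y => phase ε z y t) (Complex.I * (c₁ ε * z)) x := by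
  have h := (((Complex.ofRealCLM.hasDerivAt (x := x)).const_mul (c₁ ε * z)).add_const
    (c₂ ε * z ^ 3 * t)).add_const (c₃ ε * z ^ 2 * t) |>.const_mul Complex.I
  simpa [phase] using h

lemma hasDerivAt_phase_t (ε : ℝ) (z : ℂ) (x t : ℝ) :
    HasDerivAt (fun s => phase ε z x s) (Complex.I * (c₂ ε * z ^ 3 + c₃ ε * z ^ 2)) t := by
  have h := (((Complex.ofRealCLM.hasDerivAt (x := t)).const_mul (c₂ ε * z ^ 3)).const_add
    (c₁ ε * z * x)).add ((Complex.ofRealCLM.hasDerivAt (x := t)).const_mul (c₃ ε * z ^ 2))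
    |>.const_mul Complex.I
  simpa [phase] using h

variable {N : ℕ} (lam α β γ : Fin N → ℂ)

lemma hasDerivAt_normVecs_x (ε : ℝ) (x t : ℝ) (j : Fin N) (a : Fin 4) :
    HasDerivAt (fun y => normVecs ε lam α β γ y t j a)
      (Complex.I * (c₁ ε * lam j) * sig a * normVecs ε lam α β γ x t j a) x := by
  simp only [normVecs, normVec_apply]
  refine ((((hasDerivAt_phase_x ε (lam j) x t).const_mul (sig a)).cexp).const_mul _).congr_deriv ?_
  ring

lemma hasDerivAt_normVecs_t (ε : ℝ) (x t : ℝ) (j : Fin N) (a : Fin 4) :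
    HasDerivAt (fun s => normVecs ε lam α β γ x s j a)
      (Complex.I * (c₂ ε * lam j ^ 3 + c₃ ε * lam j ^ 2) * sig a
        * normVecs ε lam α β γ x t j a) t := by
  simp only [normVecs, normVec_apply]
  refine ((((hasDerivAt_phase_t ε (lam j) x t).const_mul (sig a)).cexp).const_mul _).congr_deriv ?_
  ring

lemma normVecs_ne_zero (ε : ℝ) (x t : ℝ) (j : Fin N) : normVecs ε lam α β γ x t j ≠ 0 := by
  intro h
  have := congrFun h 3
  simp [normVecs, normVec] at this

variable {lam} {w : Fin N → Fin 4 → ℂ}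

lemma upperMoment_zero_apply (a b : Fin 4) : upperMoment lam w 0 a b
    = -∑ k, ∑ j, (gramMatrix lam w)⁻¹ k j * (w k a * conj (w j b)) := by
  rw [upperMoment, pow_zero, Matrix.mul_one, Matrix.neg_apply, Matrix.mul_apply, Finset.sum_comm]
  simp only [Matrix.mul_apply, Finset.sum_mul, frame, of_apply, conjTranspose_apply]
  congr 1
  refine Finset.sum_congr rfl fun j _ => Finset.sum_congr rfl fun k _ => ?_
  rw [show star (w j b) = conj (w j b) from rfl]
  ring

/-- This symmetry makes the column of the potential matrix the conjugate of its row. -/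
lemma upperMoment_zero_conjTranspose (hu : IsUnit (gramMatrix lam w).det) :
    (upperMoment lam w 0)ᴴ = -upperMoment lam w 0 := by
  rw [upperMoment, pow_zero, Matrix.mul_one, conjTranspose_neg, conjTranspose_mul,
    conjTranspose_mul, conjTranspose_conjTranspose, conjTranspose_nonsing_inv,
    gramMatrix_conjTranspose]
  have : (-gramMatrix lam w)⁻¹ = -(gramMatrix lam w)⁻¹ :=
    inv_eq_left_inv (by rw [neg_mul_neg, nonsing_inv_mul _ hu])
  rw [this, Matrix.neg_mul, Matrix.mul_neg, Matrix.mul_assoc]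

lemma nSoliton_eq (ε : ℝ) (lam : Fin N → ℂ) (i : Fin 3) (x t : ℝ) : nSoliton ε lam α β γ i x t
    = -3 * Complex.I * c₁ ε * upperMoment lam (normVecs ε lam α β γ x t) 0 0 i.succ := by
  rw [upperMoment_zero_apply, nSoliton, neg_mul, neg_mul, neg_mul, mul_neg, neg_neg]
  congr 1
  refine Finset.sum_congr rfl fun k _ => Finset.sum_congr rfl fun j _ => ?_
  have h1 : normVecs ε lam α β γ x t k 0 = α k * Complex.exp (-2 * phase ε (lam k) x t) := by
    simp [normVecs, normVec]
  have h2 : normVecs ε lam α β γ x t j i.succ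
      = coeff (β j) (γ j) i * Complex.exp (phase ε (lam j) x t) := by
    fin_cases i <;> simp [normVecs, normVec, coeff]
  rw [h1, h2, Complex.exp_add, map_mul, ← Complex.exp_conj, solitonMatrix]
  ring

lemma dressedSig_zero_apply (a b : Fin 4) :
    dressedSig lam w 0 a b = (sig b - sig a) * upperMoment lam w 0 a b := by
  rw [dressedSig_zero, Matrix.sub_apply, mul_diagonal, diagonal_mul]
  ring

lemma potential_nSoliton (hlam : Function.Injective lam) (him : ∀ j, 0 < (lam j).im)
    (ε : ℝ) (x t : ℝ) :
    potential (fun i x => nSoliton ε lam α β γ i x t) x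
      = (Complex.I * c₁ ε) • dressedSig lam (normVecs ε lam α β γ x t) 0 := by
  set X := upperMoment lam (normVecs ε lam α β γ x t) 0 with hX
  have hskew : ∀ a b, conj (X a b) = -X b a := fun a b =>
    congrFun (congrFun (upperMoment_zero_conjTranspose (lam := lam)
      (w := normVecs ε lam α β γ x t)
      (gramMatrix_det_isUnit hlam him (normVecs_ne_zero lam α β γ ε x t))) b) a
  have h1 : ∀ i : Fin 3, -nSoliton ε lam α β γ i x t = Complex.I * c₁ ε * (3 * X 0 i.succ) := by
    intro i
    rw [nSoliton_eq]
    ring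
  have h2 : ∀ i : Fin 3, conj (nSoliton ε lam α β γ i x t)
      = Complex.I * c₁ ε * (-3 * X i.succ 0) := by
    intro i
    rw [nSoliton_eq, ← hX]
    simp only [map_mul, map_neg, conj_c₁, hskew, Complex.conj_I, Complex.conj_ofNat]
    ring
  ext a b
  rw [Matrix.smul_apply, dressedSig_zero_apply, ← hX, smul_eq_mul]
  refine Fin.cases ?_ (fun i => ?_) a <;> refine Fin.cases ?_ (fun j => ?_) b
  · simp [potential]
  · have : sig j.succ - sig 0 = 3 := by fin_cases j <;> simp [sig] <;> norm_num
    rw [this, ← h1]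
    fin_cases j <;> simp [potential]
  · have : sig 0 - sig i.succ = -3 := by fin_cases i <;> simp [sig] <;> norm_num
    rw [this, ← h2]
    fin_cases i <;> simp [potential]
  · have : sig j.succ - sig i.succ = 0 := by fin_cases i <;> fin_cases j <;> simp [sig]
    rw [this]
    fin_cases i <;> fin_cases j <;> simp [potential]

end Concrete

/-! ### Elimination of the auxiliary fields -/

section Elimination

/-- The first three derivatives in `x` of a potential governed by the hierarchy. Here `rₙ` and `lₙ`
are the off-diagonal row and column of the coefficient `S_(n + 1)` of `rhUpper σ rhLower`,
and the diagonal blocks have been eliminated by the quadratic relation. -/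
lemma iteratedDeriv_of_hierarchy {c : ℂ} {u : ℝ → ℂ} {r₀ r₁ r₂ r₃ l₀ l₁ : Fin 3 → ℝ → ℂ} {i : Fin 3}
    (hu : ∀ x, u x = -(Complex.I * c) * r₀ i x)
    (h₀ : ∀ i x, HasDerivAt (r₀ i) (Complex.I * c * (-3 * r₁ i x)) x)
    (hl : ∀ i x, HasDerivAt (l₀ i) (Complex.I * c * (3 * l₁ i x)) x)
    (h₁ : ∀ i x, HasDerivAt (r₁ i) (Complex.I * c *
      (-3 * r₂ i x - 2 / 3 * (∑ j, r₀ j x * l₀ j x) * r₀ i x)) x)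
    (h₂ : ∀ i x, HasDerivAt (r₂ i) (Complex.I * c * (-3 * r₃ i x
      - 1 / 3 * ((∑ j, r₀ j x * l₀ j x) * r₁ i x + (2 * ∑ j, r₀ j x * l₁ j x) * r₀ i x
        + (∑ j, r₁ j x * l₀ j x) * r₀ i x))) x) (x : ℝ) :
    deriv u x = -3 * c ^ 2 * r₁ i x ∧
    iteratedDeriv 2 u x = Complex.I * c ^ 3 * (9 * r₂ i x
      + 2 * (∑ j, r₀ j x * l₀ j x) * r₀ i x) ∧
    iteratedDeriv 3 u x = c ^ 4 * (27 * r₃ i x + 9 * (∑ j, r₀ j x * l₀ j x) * r₁ i x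
      + 9 * (∑ j, r₁ j x * l₀ j x) * r₀ i x) := by
  have hI := Complex.I_sq
  have d1 : deriv u = fun x => -3 * c ^ 2 * r₁ i x := by
    ext x
    rw [show u = fun x => -(Complex.I * c) * r₀ i x from funext hu,
      ((h₀ i x).const_mul _).deriv]
    linear_combination 3 * c ^ 2 * r₁ i x * hI
  have d2 : iteratedDeriv 2 u = fun x => Complex.I * c ^ 3 * (9 * r₂ i x
      + 2 * (∑ j, r₀ j x * l₀ j x) * r₀ i x) := by
    ext x
    rw [iteratedDeriv_succ, iteratedDeriv_one, d1, ((h₁ i x).const_mul _).deriv]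
    ring
  have hρ : ∀ x, HasDerivAt (fun x => ∑ j, r₀ j x * l₀ j x)
      (∑ j, (Complex.I * c * (-3 * r₁ j x) * l₀ j x + r₀ j x * (Complex.I * c * (3 * l₁ j x)))) x :=
    fun x => HasDerivAt.fun_sum fun j _ => (h₀ j x).mul (hl j x)
  have d3 : iteratedDeriv 3 u x = c ^ 4 * (27 * r₃ i x
      + 9 * (∑ j, r₀ j x * l₀ j x) * r₁ i x + 9 * (∑ j, r₁ j x * l₀ j x) * r₀ i x) := by
    have := (((h₂ i x).const_mul 9).fun_add (((hρ x).const_mul 2).fun_mul (h₀ i x))).const_mul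
      (Complex.I * c ^ 3)
    rw [iteratedDeriv_succ, d2, this.deriv]
    simp only [Fin.sum_univ_three]
    linear_combination -c ^ 4 * (27 * r₃ i x
      + 9 * (r₀ 0 x * l₀ 0 x + r₀ 1 x * l₀ 1 x + r₀ 2 x * l₀ 2 x) * r₁ i x
      + 9 * (r₁ 0 x * l₀ 0 x + r₁ 1 x * l₀ 1 x + r₁ 2 x * l₀ 2 x) * r₀ i x) * hI
  exact ⟨congrFun d1 x, congrFun d2 x, d3⟩

/-- The equation follows from the hierarchy by elimination. -/
lemma lhs_eq_zero_of_hierarchy {ε : ℝ} {q : Fin 3 → ℝ → ℝ → ℂ} {t : ℝ} {c c' c'' : ℂ}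
    {r₀ r₁ r₂ r₃ l₀ l₁ : Fin 3 → ℝ → ℂ}
    (hc' : c' = 9 * ε * c ^ 3) (hc'' : c'' = 3 / 2 * c ^ 2)
    (hq : ∀ i x, q i x t = -(Complex.I * c) * r₀ i x)
    (hqc : ∀ i x, conj (q i x t) = Complex.I * c * l₀ i x)
    (h₀ : ∀ i x, HasDerivAt (r₀ i) (Complex.I * c * (-3 * r₁ i x)) x)
    (hl : ∀ i x, HasDerivAt (l₀ i) (Complex.I * c * (3 * l₁ i x)) x)
    (h₁ : ∀ i x, HasDerivAt (r₁ i) (Complex.I * c *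
      (-3 * r₂ i x - 2 / 3 * (∑ j, r₀ j x * l₀ j x) * r₀ i x)) x)
    (h₂ : ∀ i x, HasDerivAt (r₂ i) (Complex.I * c * (-3 * r₃ i x
      - 1 / 3 * ((∑ j, r₀ j x * l₀ j x) * r₁ i x + (2 * ∑ j, r₀ j x * l₁ j x) * r₀ i x
        + (∑ j, r₁ j x * l₀ j x) * r₀ i x))) x)
    (ht : ∀ i x, deriv (fun s => q i x s) t = -3 * c * (c' * r₃ i x + c'' * r₂ i x))
    {i j k : Fin 3} (hijk : ∀ f : Fin 3 → ℂ, ∑ a, f a = f i + f j + f k) (x : ℝ) :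
    lhs ε (q i) (q j) (q k) x t = 0 := by
  have hd := fun i => iteratedDeriv_of_hierarchy (hq i) h₀ hl h₁ h₂ x
  have hn : ∀ i, ((‖q i x t‖ : ℂ)) ^ 2 = c ^ 2 * (r₀ i x * l₀ i x) := by
    intro i
    rw [← Complex.mul_conj', hqc, hq]
    linear_combination -c ^ 2 * (r₀ i x * l₀ i x) * Complex.I_sq
  unfold lhs
  push_cast
  rw [ht, (hd i).1, (hd j).1, (hd k).1, (hd i).2.1, (hd i).2.2, hn, hn, hn, hqc, hqc, hq, hc', hc'']
  simp only [hijk]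
  linear_combination (9 * Complex.I * ε * c ^ 4 * r₀ i x * (l₀ j x * r₁ j x + l₀ k x * r₁ k x))
    * Complex.I_sq

end Elimination

/-! ### The soliton formula solves the coupled Hirota system -/

section Solution

variable {N : ℕ} {lam : Fin N → ℂ} (α β γ : Fin N → ℂ)

lemma contDiff_phase (ε : ℝ) (z : ℂ) : ContDiff ℝ ∞ fun p : ℝ × ℝ => phase ε z p.1 p.2 := by
  unfold phase
  have h1 : ContDiff ℝ ∞ fun p : ℝ × ℝ => (p.1 : ℂ) := Complex.ofRealCLM.contDiff.comp contDiff_fst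
  have h2 : ContDiff ℝ ∞ fun p : ℝ × ℝ => (p.2 : ℂ) := Complex.ofRealCLM.contDiff.comp contDiff_snd
  fun_prop

lemma contDiff_nSoliton (hlam : Function.Injective lam) (him : ∀ j, 0 < (lam j).im) (ε : ℝ)
    (i : Fin 3) : ContDiff ℝ ∞ fun p : ℝ × ℝ => nSoliton ε lam α β γ i p.1 p.2 := by
  have hw : ∀ j a, ContDiff ℝ ∞ fun p : ℝ × ℝ => normVecs ε lam α β γ p.1 p.2 j a := by
    intro j a
    simp only [normVecs, normVec_apply]
    exact contDiff_const.mul (contDiff_const.mul (contDiff_phase ε _)).cexp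
  have hwc : ∀ j a, ContDiff ℝ ∞ fun p : ℝ × ℝ => conj (normVecs ε lam α β γ p.1 p.2 j a) :=
    fun j a => Complex.conjCLE.contDiff.comp (hw j a)
  have hK : ∀ k j, ContDiff ℝ ∞ fun p : ℝ × ℝ =>
      (gramMatrix lam (normVecs ε lam α β γ p.1 p.2))⁻¹ k j := by
    intro k j
    refine contDiff_inv (A := fun p : ℝ × ℝ => gramMatrix lam (normVecs ε lam α β γ p.1 p.2))
      (fun k j => ?_)
      (fun p => gramMatrix_det_isUnit hlam him (normVecs_ne_zero lam α β γ ε p.1 p.2)) k j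
    simp only [gramMatrix, of_apply, dotProduct]
    exact (ContDiff.sum fun a _ => (hwc k a).mul (hw j a)).div_const _
  simp only [nSoliton_eq, upperMoment_zero_apply]
  exact contDiff_const.mul (ContDiff.sum fun k _ => ContDiff.sum fun j _ =>
    (hK k j).mul ((hw k _).mul (hwc j _))).neg

lemma sig_zero : sig 0 = -2 := rfl

lemma sig_succ (i : Fin 3) : sig i.succ = 1 := by fin_cases i <;> rfl

lemma nSoliton_eq_dressedSig (ε : ℝ) (lam : Fin N → ℂ) (i : Fin 3) (x t : ℝ) :
    nSoliton ε lam α β γ i x t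
      = -(Complex.I * c₁ ε) * dressedSig lam (normVecs ε lam α β γ x t) 0 0 i.succ := by
  rw [nSoliton_eq, dressedSig_zero_apply, sig_zero, sig_succ]
  ring

theorem isSolution_nSoliton (hlam : Function.Injective lam) (him : ∀ j, 0 < (lam j).im) {ε : ℝ}
    (hε : ε ≠ 0) : IsSolution ε (nSoliton ε lam α β γ) := by
  have key : ∀ {i j k : Fin 3}, (∀ f : Fin 3 → ℂ, ∑ a, f a = f i + f j + f k) → ∀ x t,
      lhs ε (nSoliton ε lam α β γ i) (nSoliton ε lam α β γ j) (nSoliton ε lam α β γ k) x t = 0 := by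
    intro i j k hijk x t
    set w := normVecs ε lam α β γ with hw_def
    have hw : ∀ x t j, w x t j ≠ 0 := normVecs_ne_zero lam α β γ ε
    set T : ℕ → ℝ → Matrix (Fin 4) (Fin 4) ℂ := fun n x => dressedSig lam (w x t) n with hT
    have hx := fun x => hasDerivAt_normVecs_x lam α β γ ε x t
    have hQ : ∀ x, potential (fun i x => nSoliton ε lam α β γ i x t) x
        = (Complex.I * c₁ ε) • T 0 x := fun x => potential_nSoliton α β γ hlam him ε x t
    have hcol : ∀ x (i : Fin 3), conj (nSoliton ε lam α β γ i x t)
        = Complex.I * c₁ ε * T 0 x i.succ 0 := by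
      intro x i
      have := congrFun (congrFun (hQ x) i.succ) 0
      rw [Matrix.smul_apply, smul_eq_mul] at this
      rw [← this]
      fin_cases i <;> simp [potential]
    have hdiag : ∀ x, T 0 x 0 0 = 0 ∧ ∀ i j : Fin 3, T 0 x i.succ j.succ = 0 := by
      intro x
      refine ⟨?_, fun i j => ?_⟩
      · simp [hT, dressedSig_zero_apply]
      · simp [hT, dressedSig_zero_apply, sig_succ]
    have hmul : ∀ (A B : Matrix (Fin 4) (Fin 4) ℂ) a b, (A * B) a b
        = A a 0 * B 0 b + ∑ j : Fin 3, A a j.succ * B j.succ b := fun A B a b => by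
      rw [Matrix.mul_apply, Fin.sum_univ_succ]
    -- the diagonal blocks of the second and third coefficients
    have hT1 : ∀ x, -3 * T 1 x 0 0 + ∑ j : Fin 3, T 0 x 0 j.succ * T 0 x j.succ 0 = 0 ∧
        ∀ i j : Fin 3, 3 * T 1 x i.succ j.succ + T 0 x i.succ 0 * T 0 x 0 j.succ = 0 := by
      intro x
      have h := dressedSig_quadratic_one hlam him (hw x t)
      refine ⟨?_, fun i j => ?_⟩
      · have := congrFun (congrFun h 0) 0
        simp only [Matrix.add_apply, diagonal_mul, mul_diagonal, sig_zero,
          Matrix.zero_apply] at this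
        simp only [hmul] at this
        simp only [hT] at hdiag ⊢
        rw [(hdiag x).1] at this
        linear_combination this
      · have := congrFun (congrFun h i.succ) j.succ
        simp only [Matrix.add_apply, diagonal_mul, mul_diagonal, sig_succ,
          Matrix.zero_apply] at this
        simp only [hmul] at this
        simp only [hT] at hdiag ⊢
        simp only [(hdiag x).2, zero_mul, Finset.sum_const_zero] at this
        linear_combination this
    have hT2 : ∀ x, -3 * T 2 x 0 0 + ∑ j : Fin 3, T 0 x 0 j.succ * T 1 x j.succ 0
          + ∑ j : Fin 3, T 1 x 0 j.succ * T 0 x j.succ 0 = 0 ∧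
        ∀ i j : Fin 3, 3 * T 2 x i.succ j.succ + T 0 x i.succ 0 * T 1 x 0 j.succ
          + T 1 x i.succ 0 * T 0 x 0 j.succ = 0 := by
      intro x
      have h := dressedSig_quadratic_two hlam him (hw x t)
      refine ⟨?_, fun i j => ?_⟩
      · have := congrFun (congrFun h 0) 0
        simp only [Matrix.add_apply, diagonal_mul, mul_diagonal, sig_zero,
          Matrix.zero_apply] at this
        simp only [hmul] at this
        simp only [hT] at hdiag ⊢
        rw [(hdiag x).1] at this
        linear_combination this
      · have := congrFun (congrFun h i.succ) j.succ
        simp only [Matrix.add_apply, diagonal_mul, mul_diagonal, sig_succ,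
          Matrix.zero_apply] at this
        simp only [hmul] at this
        simp only [hT] at hdiag ⊢
        simp only [(hdiag x).2, zero_mul, mul_zero, Finset.sum_const_zero] at this
        linear_combination this
    have hd0 := fun x => hasEntryDerivAt_dressedSig_zero hlam him (fun y => hw y t)
      (conj_c₁ ε) (hx x)
    have hd1 := fun x => hasEntryDerivAt_dressedSig_one hlam him (fun y => hw y t)
      (conj_c₁ ε) (hx x)
    have hd2 := fun x => hasEntryDerivAt_dressedSig_two hlam him (fun y => hw y t)
      (conj_c₁ ε) (hx x)
    have hdt := fun x => hasEntryDerivAt_dressedSig_cubic hlam him (fun s => hw x s)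
      (conj_c₂ ε) (conj_c₃ ε) (hasDerivAt_normVecs_t lam α β γ ε x t)
    have hε' : (ε : ℂ) ≠ 0 := by exact_mod_cast hε
    refine lhs_eq_zero_of_hierarchy (c := c₁ ε) (c' := c₂ ε) (c'' := c₃ ε)
      (r₀ := fun i x => T 0 x 0 i.succ) (r₁ := fun i x => T 1 x 0 i.succ)
      (r₂ := fun i x => T 2 x 0 i.succ) (r₃ := fun i x => T 3 x 0 i.succ)
      (l₀ := fun i x => T 0 x i.succ 0) (l₁ := fun i x => T 1 x i.succ 0)
      ?_ ?_ (fun i x => nSoliton_eq_dressedSig α β γ ε lam i x t) (fun i x => hcol x i)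
      ?_ ?_ ?_ ?_ ?_ hijk x
    · rw [c₁, c₂]; field_simp; norm_num
    · rw [c₁, c₃]; field_simp; norm_num
    · intro i x
      refine (hd0 x 0 i.succ).congr_deriv ?_
      simp only [Matrix.smul_apply, Matrix.sub_apply, diagonal_mul, mul_diagonal, sig_zero,
        sig_succ, smul_eq_mul, hT]
      ring
    · intro i x
      refine (hd0 x i.succ 0).congr_deriv ?_
      simp only [Matrix.smul_apply, Matrix.sub_apply, diagonal_mul, mul_diagonal, sig_zero,
        sig_succ, smul_eq_mul, hT]
      ring
    · intro i x
      refine (hd1 x 0 i.succ).congr_deriv ?_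
      have e0 := hdiag x
      have e1 := hT1 x
      simp only [Matrix.smul_apply, Matrix.sub_apply, Matrix.add_apply, diagonal_mul, mul_diagonal,
        sig_zero, sig_succ, smul_eq_mul]
      simp only [hmul, Fin.sum_univ_three, hT] at e0 e1 ⊢
      simp only [e0.1, e0.2]
      linear_combination Complex.I * c₁ ε / 3 * (
        dressedSig lam (w x t) 0 0 (Fin.succ 0) * e1.2 0 i
        + dressedSig lam (w x t) 0 0 (Fin.succ 1) * e1.2 1 i
        + dressedSig lam (w x t) 0 0 (Fin.succ 2) * e1.2 2 i
        + dressedSig lam (w x t) 0 0 i.succ * e1.1)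
    · intro i x
      refine (hd2 x 0 i.succ).congr_deriv ?_
      have e0 := hdiag x
      have e2 := hT2 x
      simp only [Matrix.smul_apply, Matrix.sub_apply, Matrix.add_apply, diagonal_mul, mul_diagonal,
        sig_zero, sig_succ, smul_eq_mul]
      simp only [hmul, Fin.sum_univ_three, hT] at e0 e2 ⊢
      simp only [e0.1, e0.2]
      linear_combination Complex.I * c₁ ε / 3 * (
        dressedSig lam (w x t) 0 0 (Fin.succ 0) * e2.2 0 i
        + dressedSig lam (w x t) 0 0 (Fin.succ 1) * e2.2 1 i
        + dressedSig lam (w x t) 0 0 (Fin.succ 2) * e2.2 2 i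
        + dressedSig lam (w x t) 0 0 i.succ * e2.1)
    · intro i x
      have := (hdt x 0 i.succ).const_mul (-(Complex.I * c₁ ε))
      simp only [nSoliton_eq_dressedSig]
      rw [this.deriv]
      simp only [Matrix.smul_apply, Matrix.sub_apply, Matrix.add_apply, diagonal_mul, mul_diagonal,
        sig_zero, sig_succ, smul_eq_mul, hT]
      linear_combination (3 * c₁ ε * (c₂ ε * dressedSig lam (w x t) 3 0 i.succ
        + c₃ ε * dressedSig lam (w x t) 2 0 i.succ)) * Complex.I_sq
  exact ⟨contDiff_nSoliton α β γ hlam him ε,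
    key fun f => Fin.sum_univ_three f,
    key fun f => by rw [Fin.sum_univ_three]; ring,
    key fun f => by rw [Fin.sum_univ_three]; ring⟩

end Solution

/-! ### Large `x` limits of the rational solution -/

section Limits

variable {N : ℕ} {lam : Fin N → ℂ} {w : Fin N → Fin 4 → ℂ}

lemma diagonal_conjTranspose_of_fun (s : Fin N → ℂ) :
    (diagonal s)ᴴ = diagonal fun j => conj (s j) := diagonal_conjTranspose s

/-- The rational solution depends only on the lines spanned by the kernel vectors. -/
lemma rhUpper_smul {s : Fin N → ℂ} (hs : ∀ j, s j ≠ 0) (hu : IsUnit (gramMatrix lam w).det)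
    (z : ℂ) : rhUpper lam (fun j => s j • w j) z = rhUpper lam w z := by
  have hf : frame (fun j => s j • w j) = frame w * diagonal s := by
    ext a j
    rw [mul_diagonal]
    simp [frame, mul_comm]
  have hG : gramMatrix lam (fun j => s j • w j)
      = diagonal (fun j => conj (s j)) * gramMatrix lam w * diagonal s := by
    ext k j
    rw [mul_diagonal, diagonal_mul]
    simp only [gramMatrix, of_apply, star_smul, smul_dotProduct, dotProduct_smul, smul_eq_mul]
    rw [show star (s k) = conj (s k) from rfl]
    ring
  have hs' : ∀ j, conj (s j) ≠ 0 := fun j => (map_ne_zero _).2 (hs j)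
  have hK : (gramMatrix lam (fun j => s j • w j))⁻¹
      = diagonal (fun j => (s j)⁻¹) * (gramMatrix lam w)⁻¹ *
        diagonal (fun j => (conj (s j))⁻¹) := by
    refine inv_eq_left_inv ?_
    rw [hG]
    calc _ = diagonal (fun j => (s j)⁻¹) * (gramMatrix lam w)⁻¹ *
          (diagonal (fun j => (conj (s j))⁻¹) * diagonal (fun j => conj (s j))) *
          gramMatrix lam w * diagonal s := by simp only [Matrix.mul_assoc]
      _ = diagonal (fun j => (s j)⁻¹) * ((gramMatrix lam w)⁻¹ * gramMatrix lam w) *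
          diagonal s := by rw [diagonal_inv_mul hs']; simp only [Matrix.mul_assoc, Matrix.one_mul]
      _ = 1 := by rw [nonsing_inv_mul _ hu, Matrix.mul_one, diagonal_inv_mul hs]
  rw [rhUpper_eq, rhUpper_eq, hf, hK, conjTranspose_mul, diagonal_conjTranspose_of_fun]
  congr 1
  calc _ = frame w * (diagonal s * diagonal (fun j => (s j)⁻¹)) * (gramMatrix lam w)⁻¹ *
        (diagonal (fun j => (conj (s j))⁻¹) * diagonal (fun j => (z - conj (lam j))⁻¹)) *
        diagonal (fun j => conj (s j)) * (frame w)ᴴ := by simp only [Matrix.mul_assoc]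
    _ = frame w * (gramMatrix lam w)⁻¹ * (diagonal (fun j => (z - conj (lam j))⁻¹) *
        (diagonal (fun j => (conj (s j))⁻¹) * diagonal (fun j => conj (s j)))) * (frame w)ᴴ := by
      rw [diagonal_mul_inv hs, diagonal_mul_diagonal, diagonal_mul_diagonal, Matrix.mul_one]
      simp only [Matrix.mul_assoc, diagonal_mul_diagonal]
      simp only [← Matrix.mul_assoc]
      exact congrArg (fun f => frame w * (gramMatrix lam w)⁻¹ * diagonal f * (frame w)ᴴ)
        (funext fun j => by ring)
    _ = _ := by rw [diagonal_inv_mul hs', Matrix.mul_one]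

lemma tendsto_rhUpper_of_tendsto {X : Type*} {l : Filter X} {v : X → Fin N → Fin 4 → ℂ}
    (hv : ∀ j a, Tendsto (fun y => v y j a) l (𝓝 (w j a)))
    (hu : IsUnit (gramMatrix lam w).det) (z : ℂ) :
    Tendsto (fun y => rhUpper lam (v y) z) l (𝓝 (rhUpper lam w z)) := by
  have hconj : ∀ j a, Tendsto (fun y => conj (v y j a)) l (𝓝 (conj (w j a))) := fun j a =>
    (Complex.continuous_conj.tendsto _).comp (hv j a)
  have hG : Tendsto (fun y => gramMatrix lam (v y)) l (𝓝 (gramMatrix lam w)) := by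
    refine tendsto_pi_nhds.2 fun k => tendsto_pi_nhds.2 fun j => ?_
    exact (tendsto_finsetSum _ fun a _ => (hconj k a).mul (hv j a)).div_const _
  have hK := tendsto_matrix_inv hu.ne_zero hG
  refine tendsto_matrix fun a b => ?_
  simp only [rhUpper_apply]
  exact (tendsto_finsetSum _ fun k _ => tendsto_finsetSum _ fun j _ =>
    ((tendsto_entry hK k j).mul_const _).mul ((hv k a).mul (hconj j b))).const_sub _

variable {ε : ℝ}

lemma phase_re (ε : ℝ) (z : ℂ) (x t : ℝ) :
    (phase ε z x t).re = -(1 / (12 * ε) * z.im) * x + (phase ε z 0 t).re := by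
  have h1 : c₁ ε = ((1 / (12 * ε) : ℝ) : ℂ) := by simp [c₁]
  have h2 : phase ε z x t = ((1 / (12 * ε) * x : ℝ) : ℂ) * (Complex.I * z) + phase ε z 0 t := by
    rw [phase, phase, h1]
    push_cast
    ring
  rw [h2, Complex.add_re, Complex.re_ofReal_mul]
  simp
  ring

lemma tendsto_phase_re_atTop (hε : 0 < ε) {z : ℂ} (hz : 0 < z.im) (t : ℝ) :
    Tendsto (fun x => (phase ε z x t).re) atTop atBot := by
  refine Tendsto.congr (fun x => (phase_re ε z x t).symm) ?_
  exact tendsto_atBot_add_const_right _ _ (tendsto_id.const_mul_atTop_of_neg (by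
    have : 0 < 1 / (12 * ε) * z.im := by positivity
    linarith))

lemma tendsto_phase_re_atBot (hε : 0 < ε) {z : ℂ} (hz : 0 < z.im) (t : ℝ) :
    Tendsto (fun x => (phase ε z x t).re) atBot atTop := by
  refine Tendsto.congr (fun x => (phase_re ε z x t).symm) ?_
  exact tendsto_atTop_add_const_right _ _ (tendsto_id.const_mul_atBot_of_neg (by
    have : 0 < 1 / (12 * ε) * z.im := by positivity
    linarith))

/-- The limit of the line spanned by `w_j` as `x → ∞`. -/
def normVecsTop (α : Fin N → ℂ) (j : Fin N) : Fin 4 → ℂ := ![α j, 0, 0, 0]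

/-- The limit of the line spanned by `w_j` as `x → -∞`. -/
def normVecsBot (β γ : Fin N → ℂ) (j : Fin N) : Fin 4 → ℂ := ![0, β j, γ j, 1]

variable (hlam : Function.Injective lam) (him : ∀ j, 0 < (lam j).im)
  {α : Fin N → ℂ} (β γ : Fin N → ℂ)

lemma normVecsTop_ne_zero (hα : ∀ j, α j ≠ 0) (j : Fin N) : normVecsTop α j ≠ 0 := fun h =>
  hα j (by simpa [normVecsTop] using congrFun h 0)

lemma normVecsBot_ne_zero (j : Fin N) : normVecsBot β γ j ≠ 0 := fun h => by
  simpa [normVecsBot] using congrFun h 3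

include hlam him

lemma tendsto_rhUpper_atTop (hε : 0 < ε) (hα : ∀ j, α j ≠ 0) (t : ℝ) (z : ℂ) :
    Tendsto (fun x => rhUpper lam (normVecs ε lam α β γ x t) z) atTop
      (𝓝 (rhUpper lam (normVecsTop α) z)) := by
  -- the rescaling by `exp (2 θ_j)` makes the dominant first entry of `w_j` constant
  have h1 : ∀ x, rhUpper lam (normVecs ε lam α β γ x t) z = rhUpper lam (fun j =>
      Complex.exp (2 * phase ε (lam j) x t) • normVecs ε lam α β γ x t j) z := fun x =>
    (rhUpper_smul (fun j => Complex.exp_ne_zero _)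
      (gramMatrix_det_isUnit hlam him (normVecs_ne_zero lam α β γ ε x t)) z).symm
  simp only [h1]
  refine tendsto_rhUpper_of_tendsto (fun j a => ?_)
    (gramMatrix_det_isUnit hlam him (normVecsTop_ne_zero hα)) z
  have h0 : Tendsto (fun x => Complex.exp (2 * phase ε (lam j) x t) *
      Complex.exp (phase ε (lam j) x t)) atTop (𝓝 0) := by
    have h2 : Tendsto (fun x => Complex.exp (3 * phase ε (lam j) x t)) atTop (𝓝 0) := by
      refine Complex.tendsto_exp_nhds_zero_iff.2 ?_
      simpa using (tendsto_phase_re_atTop hε (him j) t).const_mul_atBot (by norm_num : (0 : ℝ) < 3)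
    refine h2.congr fun x => ?_
    rw [← Complex.exp_add]
    congr 1
    ring
  have h3 : ∀ b : ℂ, Tendsto (fun x => Complex.exp (2 * phase ε (lam j) x t) *
      (b * Complex.exp (phase ε (lam j) x t))) atTop (𝓝 0) := by
    intro b
    rw [← mul_zero b]
    exact (h0.const_mul b).congr fun x => by ring
  fin_cases a
  · refine tendsto_const_nhds.congr fun x => ?_
    simp only [normVecs, normVec, normVecsTop, Pi.smul_apply, smul_eq_mul, Fin.zero_eta,
      cons_val_zero]
    rw [mul_left_comm, ← Complex.exp_add]
    simp
  · exact h3 (β j)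
  · exact h3 (γ j)
  · exact h0

lemma tendsto_rhUpper_atBot (hε : 0 < ε) (α : Fin N → ℂ) (t : ℝ) (z : ℂ) :
    Tendsto (fun x => rhUpper lam (normVecs ε lam α β γ x t) z) atBot
      (𝓝 (rhUpper lam (normVecsBot β γ) z)) := by
  -- the rescaling by `exp (-θ_j)` makes the dominant last three entries of `w_j` constant
  have h1 : ∀ x, rhUpper lam (normVecs ε lam α β γ x t) z = rhUpper lam (fun j =>
      Complex.exp (-phase ε (lam j) x t) • normVecs ε lam α β γ x t j) z := fun x =>
    (rhUpper_smul (fun j => Complex.exp_ne_zero _)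
      (gramMatrix_det_isUnit hlam him (normVecs_ne_zero lam α β γ ε x t)) z).symm
  simp only [h1]
  refine tendsto_rhUpper_of_tendsto (fun j a => ?_)
    (gramMatrix_det_isUnit hlam him (normVecsBot_ne_zero β γ)) z
  have hc : ∀ b x, Complex.exp (-phase ε (lam j) x t) *
      (b * Complex.exp (phase ε (lam j) x t)) = b := by
    intro b x
    rw [mul_left_comm, ← Complex.exp_add]
    simp
  fin_cases a
  · have h2 : Tendsto (fun x => Complex.exp (-3 * phase ε (lam j) x t)) atBot (𝓝 0) := by
      refine Complex.tendsto_exp_nhds_zero_iff.2 ?_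
      simpa using (tendsto_phase_re_atBot hε (him j) t).const_mul_atTop_of_neg
        (by norm_num : (-3 : ℝ) < 0)
    have h3 := h2.const_mul (α j)
    rw [mul_zero] at h3
    refine h3.congr fun x => ?_
    simp only [normVecs, normVec, Pi.smul_apply, smul_eq_mul, Fin.zero_eta, cons_val_zero]
    rw [mul_left_comm, ← Complex.exp_add]
    congr 2
    ring
  · exact tendsto_const_nhds.congr fun x => (hc (β j) x).symm
  · exact tendsto_const_nhds.congr fun x => (hc (γ j) x).symm
  · refine tendsto_const_nhds.congr fun x => ?_
    have := hc 1 x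
    rw [one_mul] at this
    exact this.symm

end Limits

/-! ### Jost solutions and reflectionless potentials -/

/-- Block diagonal with respect to the eigenspaces of `σ`. -/
def IsSigBlock (A : Matrix (Fin 4) (Fin 4) ℂ) : Prop := ∀ a b, sig a ≠ sig b → A a b = 0

namespace IsSigBlock

variable {A B : Matrix (Fin 4) (Fin 4) ℂ}

lemma commute (hA : IsSigBlock A) (f : ℂ → ℂ) :
    A * diagonal (fun a => f (sig a)) = diagonal (fun a => f (sig a)) * A := by
  ext a b
  rw [mul_diagonal, diagonal_mul]
  by_cases h : sig a = sig b
  · rw [h, mul_comm]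
  · rw [hA a b h, zero_mul, mul_zero]

lemma mul (hA : IsSigBlock A) (hB : IsSigBlock B) : IsSigBlock (A * B) := by
  intro a b hab
  rw [Matrix.mul_apply]
  refine Finset.sum_eq_zero fun c _ => ?_
  by_cases h : sig a = sig c
  · rw [hB c b (h ▸ hab), mul_zero]
  · rw [hA a c h, zero_mul]

end IsSigBlock

lemma sig_succ_ne (i : Fin 3) : sig i.succ ≠ sig 0 := by
  rw [sig_succ, sig_zero]
  norm_num

section Columns

variable {N : ℕ} {lam : Fin N → ℂ} {w : Fin N → Fin 4 → ℂ}

lemma rhUpper_apply_of_eq_zero {z : ℂ} {a b : Fin 4} (h : (∀ j, w j a = 0) ∨ ∀ j, w j b = 0) :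
    rhUpper lam w z a b = (1 : Matrix (Fin 4) (Fin 4) ℂ) a b := by
  rw [rhUpper_apply]
  rcases h with h | h <;> simp [h]

lemma rhLower_apply_of_eq_zero {z : ℂ} {a b : Fin 4} (h : (∀ j, w j a = 0) ∨ ∀ j, w j b = 0) :
    rhLower lam w z a b = (1 : Matrix (Fin 4) (Fin 4) ℂ) a b := by
  rw [rhLower_apply]
  rcases h with h | h <;> simp [h]

lemma isSigBlock_rhUpper {z : ℂ} (h : (∀ j, w j 0 = 0) ∨ ∀ j, ∀ i : Fin 3, w j i.succ = 0) :
    IsSigBlock (rhUpper lam w z) := by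
  intro a b hab
  have hne : a ≠ b := fun h => hab (congrArg sig h)
  rw [rhUpper_apply_of_eq_zero, one_apply_ne hne]
  revert hab hne
  refine Fin.cases ?_ (fun i => ?_) a <;> refine Fin.cases ?_ (fun j => ?_) b
  · exact fun h => absurd rfl h
  · exact fun _ _ => h.imp id fun h k => h k j
  · exact fun _ _ => Or.symm (h.imp id fun h k => h k i)
  · exact fun h => absurd (by rw [sig_succ, sig_succ]) h

lemma isSigBlock_rhLower {z : ℂ} (h : (∀ j, w j 0 = 0) ∨ ∀ j, ∀ i : Fin 3, w j i.succ = 0) :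
    IsSigBlock (rhLower lam w z) := by
  intro a b hab
  have hne : a ≠ b := fun h => hab (congrArg sig h)
  rw [rhLower_apply_of_eq_zero, one_apply_ne hne]
  revert hab hne
  refine Fin.cases ?_ (fun i => ?_) a <;> refine Fin.cases ?_ (fun j => ?_) b
  · exact fun h => absurd rfl h
  · exact fun _ _ => h.imp id fun h k => h k j
  · exact fun _ _ => Or.symm (h.imp id fun h k => h k i)
  · exact fun h => absurd (by rw [sig_succ, sig_succ]) h

lemma mul_apply_of_col {A B : Matrix (Fin 4) (Fin 4) ℂ} {b : Fin 4}
    (h : ∀ c, B c b = (1 : Matrix (Fin 4) (Fin 4) ℂ) c b) (a : Fin 4) : (A * B) a b = A a b := by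
  rw [Matrix.mul_apply]
  simp only [h]
  rw [← Matrix.mul_apply, Matrix.mul_one]

lemma mul_apply_of_row {A B : Matrix (Fin 4) (Fin 4) ℂ} {a : Fin 4}
    (h : ∀ c, A a c = (1 : Matrix (Fin 4) (Fin 4) ℂ) a c) (b : Fin 4) : (A * B) a b = B a b := by
  rw [Matrix.mul_apply]
  simp only [h]
  rw [← Matrix.mul_apply, Matrix.one_mul]

lemma det_eq_of_trivial {A : Matrix (Fin 4) (Fin 4) ℂ}
    (h : ∀ a b, (∃ i : Fin 3, a = i.succ ∨ b = i.succ) →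
      A a b = (1 : Matrix (Fin 4) (Fin 4) ℂ) a b) : A.det = A 0 0 := by
  have hA : A = diagonal fun a => A a a := by
    ext a b
    by_cases hab : a = b
    · rw [hab, diagonal_apply_eq]
    · rw [diagonal_apply_ne _ hab, h, one_apply_ne hab]
      revert hab
      refine Fin.cases ?_ (fun i => ?_) a <;> refine Fin.cases ?_ (fun j => ?_) b
      · exact fun h => absurd rfl h
      · exact fun _ => ⟨j, Or.inr rfl⟩
      · exact fun _ => ⟨i, Or.inl rfl⟩
      · exact fun _ => ⟨i, Or.inl rfl⟩
  rw [hA, det_diagonal, Fin.prod_univ_succ, diagonal_apply_eq, Finset.prod_eq_one, mul_one]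
  intro i _
  rw [h _ _ ⟨i, Or.inl rfl⟩, one_apply_eq]

end Columns

section Reflectionless

variable {N : ℕ} {lam : Fin N → ℂ} {ε : ℝ} {α : Fin N → ℂ} (β γ : Fin N → ℂ)
  (hlam : Function.Injective lam) (him : ∀ j, 0 < (lam j).im)

include hlam him

lemma hasEntryDerivAt_rhUpper_normVecs (ε : ℝ) (α : Fin N → ℂ) (t : ℝ) (k x : ℝ) :
    HasEntryDerivAt (fun y => rhUpper lam (normVecs ε lam α β γ y t) k)
      ((Complex.I * k * c₁ ε) • (diagonal sig * rhUpper lam (normVecs ε lam α β γ x t) k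
          - rhUpper lam (normVecs ε lam α β γ x t) k * diagonal sig)
        + potential (fun i x => nSoliton ε lam α β γ i x t) x
          * rhUpper lam (normVecs ε lam α β γ x t) k) x := by
  rw [potential_nSoliton α β γ hlam him, dressedSig_zero]
  exact hasEntryDerivAt_rhUpper hlam him (fun y => normVecs_ne_zero lam α β γ ε y t) (conj_c₁ ε)
    (hasDerivAt_normVecs_x lam α β γ ε x t) (sub_conj_ne_zero_of_im_nonneg him (by simp))

/-- Normalizing `rhUpper` at `±∞` by a matrix that commutes with `σ` gives a Jost solution. -/
lemma isJost_rhUpper_mul (ε : ℝ) (α : Fin N → ℂ) (t k : ℝ) {l : Filter ℝ}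
    {A C : Matrix (Fin 4) (Fin 4) ℂ}
    (hl : Tendsto (fun x => rhUpper lam (normVecs ε lam α β γ x t) k) l (𝓝 A))
    (hC : IsSigBlock C) (hAC : A * C = 1) :
    IsJost ε (fun i x => nSoliton ε lam α β γ i x t) l k
      (fun x => rhUpper lam (normVecs ε lam α β γ x t) k * C) where
  ode x a b := by
    have h := (hasEntryDerivAt_rhUpper_normVecs β γ hlam him ε α t k x).mul_const C
    refine h.congr_deriv ?_ a b
    have hc : diagonal sig * C = C * diagonal sig := (hC.commute id).symm
    rw [Matrix.add_mul, Matrix.smul_mul, Matrix.sub_mul]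
    simp only [Matrix.mul_assoc, hc]
  normalized := by
    rw [← hAC]
    exact hl.mul_const C

/-- The Jost solutions are `rhUpper` normalized by its limits, and the scattering matrix is the
quotient of the two limits. As one limit differs from the identity only in the `(0, 0)` entry and
the other only in the lower `3 × 3` block, the relevant columns and rows are those of `rhUpper` and
`rhLower`. -/
theorem isReflectionless_nSoliton (hε : 0 < ε) (hα : ∀ j, α j ≠ 0) (t : ℝ) :
    IsReflectionless ε (fun i x => nSoliton ε lam α β γ i x t) lam
      (fun x => normVecs ε lam α β γ x t) := by
  set w := fun x => normVecs ε lam α β γ x t with hw_def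
  have hw : ∀ x j, w x j ≠ 0 := fun x => normVecs_ne_zero lam α β γ ε x t
  have hp := normVecsTop_ne_zero hα
  have hm := normVecsBot_ne_zero β γ
  have hk : ∀ k : ℝ, ∀ j, (k : ℂ) - lam j ≠ 0 := fun k => sub_ne_zero_of_im_nonpos him (by simp)
  have hk' : ∀ k : ℝ, ∀ j, (k : ℂ) - conj (lam j) ≠ 0 := fun k =>
    sub_conj_ne_zero_of_im_nonneg him (by simp)
  have hinv : ∀ {v : Fin N → Fin 4 → ℂ}, (∀ j, v j ≠ 0) → ∀ k : ℝ,
      rhLower lam v k * rhUpper lam v k = 1 := fun hv k =>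
    rhLower_mul_rhUpper hlam him hv (hk k) (hk' k)
  have hinv' : ∀ {v : Fin N → Fin 4 → ℂ}, (∀ j, v j ≠ 0) → ∀ k : ℝ,
      rhUpper lam v k * rhLower lam v k = 1 := fun hv k => mul_eq_one_comm.1 (hinv hv k)
  set p : Fin N → Fin 4 → ℂ := normVecsTop α with hp_def
  set m : Fin N → Fin 4 → ℂ := normVecsBot β γ with hm_def
  have hp0 : ∀ j, ∀ i : Fin 3, p j i.succ = 0 := fun j i => by
    fin_cases i <;> simp [hp_def, normVecsTop]
  have hm0 : ∀ j, m j 0 = 0 := fun j => by simp [hm_def, normVecsBot]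
  have hpU : ∀ k : ℝ, IsSigBlock (rhUpper lam p k) := fun k => isSigBlock_rhUpper (Or.inr hp0)
  have hpL : ∀ k : ℝ, IsSigBlock (rhLower lam p k) := fun k => isSigBlock_rhLower (Or.inr hp0)
  have hmU : ∀ k : ℝ, IsSigBlock (rhUpper lam m k) := fun k => isSigBlock_rhUpper (Or.inl hm0)
  have hmL : ∀ k : ℝ, IsSigBlock (rhLower lam m k) := fun k => isSigBlock_rhLower (Or.inl hm0)
  have hSinv : ∀ k : ℝ, (rhUpper lam p k * rhLower lam m k)⁻¹
      = rhUpper lam m k * rhLower lam p k := fun k => inv_eq_right_inv (by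
    rw [Matrix.mul_assoc, ← Matrix.mul_assoc (rhLower lam m k), hinv hm, Matrix.one_mul, hinv' hp])
  have hJinv : ∀ {v : Fin N → Fin 4 → ℂ}, (∀ j, v j ≠ 0) → ∀ k x : ℝ,
      (rhUpper lam (w x) k * rhLower lam v k)⁻¹ = rhUpper lam v k * rhLower lam (w x) k :=
    fun hv k x => inv_eq_right_inv (by
      rw [Matrix.mul_assoc, ← Matrix.mul_assoc (rhLower lam _ k), hinv hv, Matrix.one_mul,
        hinv' (hw x)])
  refine ⟨fun k x => rhUpper lam (w x) k * rhLower lam m k,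
    fun k x => rhUpper lam (w x) k * rhLower lam p k,
    fun k => rhUpper lam p k * rhLower lam m k,
    fun x => rhUpper lam (w x), fun x => rhLower lam (w x), ?_, ?_, ?_, ?_, ?_, ?_, ?_, ?_⟩
  · exact fun k => isJost_rhUpper_mul β γ hlam him ε α t k
      (tendsto_rhUpper_atBot hlam him β γ hε α t k) (hmL k) (hinv' hm k)
  · exact fun k => isJost_rhUpper_mul β γ hlam him ε α t k
      (tendsto_rhUpper_atTop hlam him β γ hε hα t k) (hpL k) (hinv' hp k)
  · intro k x
    have h1 := ((hpU k).mul (hmL k)).commute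
      (fun y => Complex.exp (Complex.I * c₁ ε * k * y * x))
    change _ = freeSol ε k x * _ at h1
    rw [Matrix.mul_assoc _ (freeSol ε k x), ← h1, Matrix.mul_assoc _ (rhLower lam p k),
      ← Matrix.mul_assoc (rhLower lam p k), ← Matrix.mul_assoc (rhLower lam p k), hinv hp,
      Matrix.one_mul, Matrix.mul_assoc]
    rfl
  · intro k i
    refine ⟨(hpU k).mul (hmL k) _ _ (sig_succ_ne i), ?_⟩
    rw [hSinv]
    exact (hmU k).mul (hpL k) _ _ (sig_succ_ne i).symm
  · intro k x a
    refine ⟨(mul_apply_of_col (fun c => rhLower_apply_of_eq_zero (Or.inr hm0)) a).symm, fun i => ?_⟩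
    exact (mul_apply_of_col (fun c => rhLower_apply_of_eq_zero (Or.inr fun j => hp0 j i)) a).symm
  · intro k x b
    rw [hJinv hm, hJinv hp]
    refine ⟨(mul_apply_of_row (fun c => rhUpper_apply_of_eq_zero (Or.inl hm0)) b).symm, fun i => ?_⟩
    exact (mul_apply_of_row (fun c => rhUpper_apply_of_eq_zero (Or.inl fun j => hp0 j i)) b).symm
  · intro k x
    have e1 : (rhUpper lam p k * rhLower lam m k) 0 0 = rhUpper lam p k 0 0 :=
      mul_apply_of_col (fun c => rhLower_apply_of_eq_zero (Or.inr hm0)) 0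
    have e2 : (rhUpper lam m k * rhLower lam p k) 0 0 = rhLower lam p k 0 0 :=
      mul_apply_of_row (fun c => rhUpper_apply_of_eq_zero (Or.inl hm0)) 0
    beta_reduce
    rw [hSinv, e1, e2, rhUpper_det hlam him (hw x) (hk' k), rhLower_det hlam him (hw x) (hk k),
      ← rhUpper_det hlam him hp (hk' k), ← rhLower_det hlam him hp (hk k)]
    refine ⟨det_eq_of_trivial ?_, det_eq_of_trivial ?_⟩
    · rintro a b ⟨i, rfl | rfl⟩
      · exact rhUpper_apply_of_eq_zero (Or.inl fun j => hp0 j i)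
      · exact rhUpper_apply_of_eq_zero (Or.inr fun j => hp0 j i)
    · rintro a b ⟨i, rfl | rfl⟩
      · exact rhLower_apply_of_eq_zero (Or.inl fun j => hp0 j i)
      · exact rhLower_apply_of_eq_zero (Or.inr fun j => hp0 j i)
  · exact fun x => isRHSolution_rational hlam him (hw x)

/-- A reflectionless potential is determined by its discrete data: its `P₁` is the rational
solution of the Riemann-Hilbert problem, and at `k = 0` the spectral problem reads `P₁' = Q P₁`. -/
theorem IsReflectionless.eq_nSoliton {t : ℝ} {u : Fin 3 → ℝ → ℂ}
    (h : IsReflectionless ε u lam (fun x => normVecs ε lam α β γ x t)) :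
    u = fun i x => nSoliton ε lam α β γ i x t := by
  obtain ⟨Jm, Jp, S, P₁, P₂, hJm, hJp, -, -, hP₁, -, -, hRH⟩ := h
  have hw : ∀ x j, normVecs ε lam α β γ x t j ≠ 0 := fun x => normVecs_ne_zero lam α β γ ε x t
  have hP : ∀ x, P₁ x (0 : ℝ) = rhUpper lam (normVecs ε lam α β γ x t) (0 : ℝ) := fun x =>
    (rhSolution_unique hlam him (hw x) (hRH x)).1 (by simp)
  have hu : ∀ x, HasEntryDerivAt (fun y => rhUpper lam (normVecs ε lam α β γ y t) (0 : ℝ))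
      (potential u x * rhUpper lam (normVecs ε lam α β γ x t) (0 : ℝ)) x := by
    intro x
    simp only [← hP]
    have key : ∀ {l : Filter ℝ} {J : ℝ → Matrix (Fin 4) (Fin 4) ℂ} {b : Fin 4},
        IsJost ε u l 0 J → (∀ x a, P₁ x (0 : ℝ) a b = J x a b) → ∀ a,
        HasDerivAt (fun y => P₁ y (0 : ℝ) a b) ((potential u x * P₁ x (0 : ℝ)) a b) x := by
      intro l J b hJ hb a
      have h1 := hJ.ode x a b
      simp only [Complex.ofReal_zero, mul_zero, zero_mul, zero_smul, zero_add] at h1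
      simp only [hb, Matrix.mul_apply] at h1 ⊢
      exact h1
    intro a b
    revert a
    refine Fin.cases ?_ (fun i => ?_) b
    · exact key (hJm 0) fun x a => (hP₁ 0 x a).1
    · exact key (hJp 0) fun x a => (hP₁ 0 x a).2 i
  have hpot : ∀ x, potential u x = potential (fun i x => nSoliton ε lam α β γ i x t) x := by
    intro x
    have h1 := (hu x).unique (hasEntryDerivAt_rhUpper_normVecs β γ hlam him ε α t 0 x)
    simp only [Complex.ofReal_zero, mul_zero, zero_mul, zero_smul, zero_add] at h1
    have h2 : rhUpper lam (normVecs ε lam α β γ x t) 0 * rhLower lam (normVecs ε lam α β γ x t) 0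
        = 1 := mul_eq_one_comm.1 (rhLower_mul_rhUpper hlam him (hw x)
      (sub_ne_zero_of_im_nonpos him (by simp)) (sub_conj_ne_zero_of_im_nonneg him (by simp)))
    have h3 := congrArg (· * rhLower lam (normVecs ε lam α β γ x t) 0) h1
    simpa only [Matrix.mul_assoc, h2, Matrix.mul_one] using h3
  funext i x
  have := congrFun (congrFun (hpot x) 0) i.succ
  revert this
  fin_cases i <;> simp [potential]

end Reflectionless

/-! ### One and two solitons -/

lemma gramMatrix_normVec (ε : ℝ) (z' a' b' g' z a b g : ℂ) (x t : ℝ) :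
    (star (normVec ε z' a' b' g' x t) ⬝ᵥ normVec ε z a b g x t) / (z - conj z')
      = entry ε z' a' b' g' z a b g x t := by
  rw [entry]
  congr 1
  simp only [dotProduct, Fin.sum_univ_four, Pi.star_apply, normVec, cons_val]
  simp only [show ∀ y : ℂ, star y = conj y from fun _ => rfl, map_mul, ← Complex.exp_conj, map_neg,
    Complex.conj_ofNat, mul_add, Complex.exp_add]
  ring

lemma solitonMatrix_one (ε : ℝ) (z a b g : ℂ) (x t : ℝ) :
    solitonMatrix ε ![z] ![a] ![b] ![g] x t = !![entry ε z a b g z a b g x t] := by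
  ext i j
  fin_cases i; fin_cases j
  exact gramMatrix_normVec ε z a b g z a b g x t

lemma solitonMatrix_two (ε : ℝ) (z₁ a₁ b₁ g₁ z₂ a₂ b₂ g₂ : ℂ) (x t : ℝ) :
    solitonMatrix ε ![z₁, z₂] ![a₁, a₂] ![b₁, b₂] ![g₁, g₂] x t
      = !![entry ε z₁ a₁ b₁ g₁ z₁ a₁ b₁ g₁ x t, entry ε z₁ a₁ b₁ g₁ z₂ a₂ b₂ g₂ x t;
         entry ε z₂ a₂ b₂ g₂ z₁ a₁ b₁ g₁ x t, entry ε z₂ a₂ b₂ g₂ z₂ a₂ b₂ g₂ x t] := by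
  ext i j
  fin_cases i <;> fin_cases j <;> exact gramMatrix_normVec ε _ _ _ _ _ _ _ _ x t

lemma nSoliton_one (ε : ℝ) (z a b g : ℂ) :
    nSoliton ε ![z] ![a] ![b] ![g] = oneSoliton ε z a b g := by
  funext i x t
  simp only [nSoliton, oneSoliton, solitonMatrix_one, Fin.sum_univ_one, cons_val]
  ring

lemma nSoliton_two (ε : ℝ) (z₁ a₁ b₁ g₁ z₂ a₂ b₂ g₂ : ℂ) :
    nSoliton ε ![z₁, z₂] ![a₁, a₂] ![b₁, b₂] ![g₁, g₂]
      = twoSoliton ε z₁ a₁ b₁ g₁ z₂ a₂ b₂ g₂ := by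
  funext i x t
  simp only [nSoliton, twoSoliton, solitonMatrix_two, Fin.sum_univ_two, cons_val]
  ring

end TcCH

theorem mainTheorem1 (ε : ℝ) (hε : ε ≠ 0) :
    (∀ (N : ℕ) (lam α β γ : Fin N → ℂ), Function.Injective lam → (∀ j, 0 < (lam j).im) →
      -- the matrix `M` is invertible everywhere
      (∀ x t, IsUnit (TcCH.solitonMatrix ε lam α β γ x t).det) ∧
      -- the reflectionless Riemann-Hilbert problem has exactly one solution, given explicitly
      (∀ x t,
        TcCH.IsRHSolution lam (TcCH.normVecs ε lam α β γ x t)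
          (TcCH.rhUpper lam (TcCH.normVecs ε lam α β γ x t))
          (TcCH.rhLower lam (TcCH.normVecs ε lam α β γ x t)) ∧
        (∀ P₁ P₂ : ℂ → Matrix (Fin 4) (Fin 4) ℂ,
          TcCH.IsRHSolution lam (TcCH.normVecs ε lam α β γ x t) P₁ P₂ →
            Set.EqOn P₁ (TcCH.rhUpper lam (TcCH.normVecs ε lam α β γ x t)) {z | 0 ≤ z.im} ∧
            Set.EqOn P₂ (TcCH.rhLower lam (TcCH.normVecs ε lam α β γ x t)) {z | z.im ≤ 0}) ∧
        -- and the soliton formula is the potential reconstructed from it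
        (∀ i : Fin 3, Tendsto
          (fun z : ℂ => -3 * Complex.I * TcCH.c₁ ε *
            (z * TcCH.rhUpper lam (TcCH.normVecs ε lam α β γ x t) z 0 i.succ))
          (cobounded ℂ) (𝓝 (TcCH.nSoliton ε lam α β γ i x t)))) ∧
      -- the soliton formula solves the three-component coupled Hirota system
      TcCH.IsSolution ε (TcCH.nSoliton ε lam α β γ) ∧
      -- at each time it is the unique reflectionless potential with the given discrete data
      (0 < ε → (∀ j, α j ≠ 0) → ∀ (t : ℝ) (u : Fin 3 → ℝ → ℂ),
        TcCH.IsReflectionless ε u lam (fun x => TcCH.normVecs ε lam α β γ x t) ↔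
          u = fun i x => TcCH.nSoliton ε lam α β γ i x t)) ∧
    -- the case `N = 1`
    (∀ z₁ a₁ b₁ g₁ : ℂ, 0 < z₁.im →
      TcCH.nSoliton ε ![z₁] ![a₁] ![b₁] ![g₁] = TcCH.oneSoliton ε z₁ a₁ b₁ g₁ ∧
      TcCH.IsSolution ε (TcCH.oneSoliton ε z₁ a₁ b₁ g₁)) ∧
    -- the case `N = 2`
    (∀ z₁ a₁ b₁ g₁ z₂ a₂ b₂ g₂ : ℂ, 0 < z₁.im → 0 < z₂.im → z₁ ≠ z₂ →
      TcCH.nSoliton ε ![z₁, z₂] ![a₁, a₂] ![b₁, b₂] ![g₁, g₂] =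
        TcCH.twoSoliton ε z₁ a₁ b₁ g₁ z₂ a₂ b₂ g₂ ∧
      TcCH.IsSolution ε (TcCH.twoSoliton ε z₁ a₁ b₁ g₁ z₂ a₂ b₂ g₂)) := by
  refine ⟨fun N lam α β γ hlam him => ?_, fun z₁ a₁ b₁ g₁ h₁ => ?_,
    fun z₁ a₁ b₁ g₁ z₂ a₂ b₂ g₂ h₁ h₂ hne => ?_⟩
  · have hw := TcCH.normVecs_ne_zero lam α β γ ε
    refine ⟨fun x t => TcCH.gramMatrix_det_isUnit hlam him (hw x t), fun x t =>
      ⟨TcCH.isRHSolution_rational hlam him (hw x t),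
        fun P₁ P₂ h => TcCH.rhSolution_unique hlam him (hw x t) h, fun i => ?_⟩,
      TcCH.isSolution_nSoliton α β γ hlam him hε, fun hpos hα t u => ⟨fun h =>
        h.eq_nSoliton β γ hlam him, fun h => ?_⟩⟩
    · rw [TcCH.nSoliton_eq, TcCH.upperMoment_zero_apply]
      exact (TcCH.tendsto_mul_rhUpper (Fin.succ_ne_zero i).symm).const_mul _
    · rw [h]
      exact TcCH.isReflectionless_nSoliton β γ hlam him hpos hα t
  · refine ⟨TcCH.nSoliton_one ε z₁ a₁ b₁ g₁, ?_⟩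
    rw [← TcCH.nSoliton_one]
    refine TcCH.isSolution_nSoliton _ _ _ (Function.injective_of_subsingleton _) (fun j => ?_) hε
    fin_cases j
    exact h₁
  · refine ⟨TcCH.nSoliton_two ε z₁ a₁ b₁ g₁ z₂ a₂ b₂ g₂, ?_⟩
    rw [← TcCH.nSoliton_two]
    refine TcCH.isSolution_nSoliton _ _ _ (fun i j hij => ?_) (fun j => ?_) hε
    · fin_cases i <;> fin_cases j
      · rfl
      · exact absurd hij hne
      · exact absurd hij.symm hne
      · rfl
    · fin_cases j
      · exact h₁
      · exact h₂
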